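/- Let $R$ be a commutative Noetherian ring and let $C$ be a semidualizing $R$-module, i.e. a finitely generated $R$-module such that the homothety map $R\to\operatorname{Hom}_R(C,C)$ is an isomorphism and $\operatorname{Ext}^i_R(C,C)=0$ for all $i>0$. Modules need not be finitely generated. **Classes.** The Auslander class $\mathcal A_C(R)$ consists of the $R$-modules $M$ for which the natural map $M\to\operatorname{Hom}_R(C,C\otimes_RM)$ is an isomorphism and $\operatorname{Tor}^R_{i}(C,M)=0=\operatorname{Ext}^{i}_R(C,C\otimes_RM)$ for all $i>0$. The Bass class $\mathcal B_C(R)$ consists of the $R$-modules $M$ for which the evaluation map $C\otimes_R\operatorname{Hom}_R(C,M)\to M$ is an isomorphism and $\operatorname{Ext}^{i}_R(C,M)=0=\operatorname{Tor}^R_{i}(C,\operatorname{Hom}_R(C,M))$ for all $i>0$. **Resolutions and dimensions.** For a complex $X$ of $R$-modules (indexed by $\mathbb Z$, with differentials $X_i\to X_{i-1}$) let $\sup X$, $\inf X$ be the supremum and infimum in $\mathbb Z\cup\{\pm\infty\}$ of $\{i\mid X_i\neq0\}$, and $\operatorname{hsup}X$, $\operatorname{hinf}X$ those of $\{i\mid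 \operatorname H_i(X)\ne0\}$. The complex $X$ is bounded below if $\inf X>-\infty$, bounded above if $\sup X<\infty$, and bounded if it is both. * A quasi-projective resolution of $M$ is a bounded below complex $P$ of projective modules for which there are integers $a_i\ge0$ ($i\ge\inf P$), not all zero, with $\operatorname H_i(P)\cong M^{\oplus a_i}$ for all $i\geq \inf P$. A quasi-injective resolution of $M$ is a bounded above complex $I$ of injective modules for which there are integers $b_i\ge0$ ($i\le\sup I$), not all zero, with $\operatorname H_i(I)\cong M^{\oplus b_i}$ for all $i\le\sup I$. * A $C$-quasi-projective resolution of $M$ is a bounded complex $P$ of projective modules such that $P\otimes_RC$ is not acyclic and each $\operatorname H_i(P\otimes_RC)$ is a finite (possibly zero) direct sum of copies of $M$. A $C$-quasi-injective resolution of $M$ is a bounded complex $I$ of injective modules such that $\operatorname{Hom}_R(C,I)$ is not acyclic and each $\operatorname H_i(\operatorname{Hom}_R(C,I))$ is a finite (possibly zero) direct sum of copies of $M$. * For $M\neq0$ define, with $\inf\emptyset=+\infty$, - $\operatorname{qpd}_RM=\inf\{\sup P-\operatorname{hsup}P\}$ over the bounded quasi-projective resolutions $P$ of $M$; - $\operatorname{qid}_RM=\inf\{\operatorname{hinf}I-\inf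 I\}$ over the bounded quasi-injective resolutions $I$ of $M$; - $C\text{-}\operatorname{qpd}_RM=\inf\{\sup(P\otimes_RC)-\operatorname{hsup}(P\otimes_RC)\}$ over the $C$-quasi-projective resolutions $P$ of $M$; - $C\text{-}\operatorname{qid}_RM=\inf\{\operatorname{hinf}\operatorname{Hom}_R(C,I)-\inf\operatorname{Hom}_R(C,I)\}$ over the $C$-quasi-injective resolutions $I$ of $M$. All four are $-\infty$ for $M=0$. **Theorem (transfer formulae).** Let $M$ be an $R$-module. 1. If $M\in\mathcal B_C(R)$, then $C\text{-}\operatorname{qpd}_RM<\infty$ if and only if $\operatorname{qpd}_R\operatorname{Hom}_R(C,M)<\infty$, and $C\text{-}\operatorname{qpd}_RM=\operatorname{qpd}_R\operatorname{Hom}_R(C,M)$. If moreover $M\ne0$, then a complex $P$ is a $C$-quasi-projective resolution of $M$ if and only if it is a bounded quasi-projective resolution of $\operatorname{Hom}_R(C,M)$. 2. If $M\in\mathcal A_C(R)$, then $\operatorname{qpd}_RM<\infty$ if and only if $C\text{-}\operatorname{qpd}_R(C\otimes_RM)<\infty$, and $\operatorname{qpd}_RM=C\text{-}\operatorname{qpd}_R(C\otimes_RM)$.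 If moreover $M\ne0$, then a complex $P$ is a bounded quasi-projective resolution of $M$ if and only if it is a $C$-quasi-projective resolution of $C\otimes_RM$. 3. If $M\in\mathcal A_C(R)$, then $C\text{-}\operatorname{qid}_RM<\infty$ if and only if $\operatorname{qid}_R(C\otimes_RM)<\infty$, and $C\text{-}\operatorname{qid}_RM=\operatorname{qid}_R(C\otimes_RM)$. If moreover $M\ne0$, then a complex $I$ is a $C$-quasi-injective resolution of $M$ if and only if it is a bounded quasi-injective resolution of $C\otimes_RM$. 4. If $M\in\mathcal B_C(R)$, then $C\text{-}\operatorname{qid}_R\operatorname{Hom}_R(C,M)<\infty$ if and only if $\operatorname{qid}_RM<\infty$, and $C\text{-}\operatorname{qid}_R\operatorname{Hom}_R(C,M)=\operatorname{qid}_RM$. If moreover $M\ne0$, then a complex $I$ is a bounded quasi-injective resolution of $M$ if and only if it is a $C$-quasi-injective resolution of $\operatorname{Hom}_R(C,M)$. -/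

import Mathlib

open CategoryTheory CategoryTheory.MonoidalCategory CategoryTheory.Limits

universe u

noncomputable section

namespace QuasiDim

/-! ### Suprema and infima of complexes -/

section Complexes

variable {R : Type u} [CommRing R]

/-- Complexes of `R`-modules, graded homologically: `X.d i (i - 1) : X.X i ⟶ X.X (i - 1)`. -/
abbrev Cplx (R : Type u) [CommRing R] := ChainComplex (ModuleCat.{u} R) ℤ

/-- `sup X = sup {i | X_i ≠ 0}`, with value `-∞` on the zero complex. -/
def csup (X : Cplx R) : EReal := sSup {e : EReal | ∃ i : ℤ, ¬ IsZero (X.X i) ∧ e = (i : ℝ)}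

/-- `inf X = inf {i | X_i ≠ 0}`, with value `+∞` on the zero complex. -/
def cinf (X : Cplx R) : EReal := sInf {e : EReal | ∃ i : ℤ, ¬ IsZero (X.X i) ∧ e = (i : ℝ)}

/-- `hsup X = sup {i | H_i(X) ≠ 0}`. -/
def hsup (X : Cplx R) : EReal :=
  sSup {e : EReal | ∃ i : ℤ, ¬ IsZero (X.homology i) ∧ e = (i : ℝ)}

/-- `hinf X = inf {i | H_i(X) ≠ 0}`. -/
def hinf (X : Cplx R) : EReal :=
  sInf {e : EReal | ∃ i : ℤ, ¬ IsZero (X.homology i) ∧ e = (i : ℝ)}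

def BoundedBelow (X : Cplx R) : Prop := ⊥ < cinf X

def BoundedAbove (X : Cplx R) : Prop := csup X < ⊤

def Bounded (X : Cplx R) : Prop := BoundedBelow X ∧ BoundedAbove X

/-- `N ≅ M^{⊕ n}`; for `n = 0` this says `N = 0`. -/
def IsoPow (N M : ModuleCat.{u} R) (n : ℕ) : Prop := Nonempty (N ≃ₗ[R] (Fin n → M))

end Complexes

/-! ### The functors `Hom(C, -)` and `- ⊗ C` -/

section Functors

variable {R : Type u} [CommRing R]

/-- The module `Hom_R(C, M)`. -/
abbrev homMod (C M : ModuleCat.{u} R) : ModuleCat.{u} R := ModuleCat.of R (C →ₗ[R] M)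

/-- The module `C ⊗_R M`. -/
abbrev tensorMod (C M : ModuleCat.{u} R) : ModuleCat.{u} R :=
  ModuleCat.of R (TensorProduct R C M)

/-- The functor `Hom_R(C, -)`. -/
def homFunctor (C : ModuleCat.{u} R) : ModuleCat.{u} R ⥤ ModuleCat.{u} R where
  obj M := homMod C M
  map f := ModuleCat.ofHom (LinearMap.compRight R f.hom)

instance (C : ModuleCat.{u} R) : (homFunctor C).Additive where
  map_add {M N f g} := by
    ext (h : C →ₗ[R] M)
    refine LinearMap.ext fun c => ?_
    rfl

/-- The complex `Hom_R(C, X)`. -/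
def homCplx (C : ModuleCat.{u} R) (X : Cplx R) : Cplx R :=
  ((homFunctor C).mapHomologicalComplex _).obj X

/-- The complex `X ⊗_R C`. -/
def tensorCplx (X : Cplx R) (C : ModuleCat.{u} R) : Cplx R :=
  ((tensorRight C).mapHomologicalComplex _).obj X

end Functors

/-! ### Semidualizing modules, Auslander and Bass classes -/

section Classes

variable {R : Type u} [CommRing R]

/-- `Ext^i_R(M, N) = 0` for all `i > 0`. -/
def ExtVanish (M N : ModuleCat.{u} R) : Prop :=
  ∀ i : ℕ, 0 < i → Subsingleton (Abelian.Ext.{u} M N i)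

/-- `Tor_i^R(M, N) = 0` for all `i > 0`. -/
def TorVanish (M N : ModuleCat.{u} R) : Prop :=
  ∀ i : ℕ, 0 < i → IsZero (((Tor (ModuleCat.{u} R) i).obj M).obj N)

structure IsSemidualizing (C : ModuleCat.{u} R) : Prop where
  finite : Module.Finite R C
  /-- the homothety map `R → Hom_R(C, C)` is an isomorphism -/
  homothety : Function.Bijective (LinearMap.lsmul R C : R →ₗ[R] C →ₗ[R] C)
  ext : ExtVanish C C

/-- `M` belongs to the Auslander class of `R` with respect to `C`. -/
structure InAuslander (C M : ModuleCat.{u} R) : Prop where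
  /-- the natural map `M → Hom_R(C, C ⊗ M)`, `m ↦ (c ↦ c ⊗ m)`, is an isomorphism -/
  unit : Function.Bijective ((TensorProduct.mk R C M).flip : M →ₗ[R] C →ₗ[R] TensorProduct R C M)
  tor : TorVanish C M
  ext : ExtVanish C (tensorMod C M)

/-- `M` belongs to the Bass class of `R` with respect to `C`. -/
structure InBass (C M : ModuleCat.{u} R) : Prop where
  /-- the evaluation map `C ⊗ Hom_R(C, M) → M`, `c ⊗ f ↦ f c`, is an isomorphism -/
  eval : Function.Bijective (TensorProduct.lift
    (LinearMap.applyₗ : C →ₗ[R] (C →ₗ[R] M) →ₗ[R] M))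
  ext : ExtVanish C M
  tor : TorVanish C (homMod C M)

end Classes

/-! ### Quasi-projective and quasi-injective dimensions -/

section Dimensions

variable {R : Type u} [CommRing R]

/-- `P` is a quasi-projective resolution of `M`. -/
structure IsQProjRes (M : ModuleCat.{u} R) (P : Cplx R) : Prop where
  boundedBelow : BoundedBelow P
  projective : ∀ i, Module.Projective R (P.X i)
  homology : ∃ a : ℤ → ℕ, (∃ i : ℤ, cinf P ≤ ((i : ℝ) : EReal) ∧ a i ≠ 0) ∧
    ∀ i : ℤ, cinf P ≤ ((i : ℝ) : EReal) → IsoPow (P.homology i) M (a i)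

/-- `I` is a quasi-injective resolution of `M`. -/
structure IsQInjRes (M : ModuleCat.{u} R) (I : Cplx R) : Prop where
  boundedAbove : BoundedAbove I
  injective : ∀ i, Module.Injective R (I.X i)
  homology : ∃ b : ℤ → ℕ, (∃ i : ℤ, ((i : ℝ) : EReal) ≤ csup I ∧ b i ≠ 0) ∧
    ∀ i : ℤ, ((i : ℝ) : EReal) ≤ csup I → IsoPow (I.homology i) M (b i)

/-- `P` is a `C`-quasi-projective resolution of `M`. -/
structure IsCQProjRes (C M : ModuleCat.{u} R) (P : Cplx R) : Prop where
  bounded : Bounded P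
  projective : ∀ i, Module.Projective R (P.X i)
  not_acyclic : ¬ (tensorCplx P C).Acyclic
  homology : ∀ i : ℤ, ∃ a : ℕ, IsoPow ((tensorCplx P C).homology i) M a

/-- `I` is a `C`-quasi-injective resolution of `M`. -/
structure IsCQInjRes (C M : ModuleCat.{u} R) (I : Cplx R) : Prop where
  bounded : Bounded I
  injective : ∀ i, Module.Injective R (I.X i)
  not_acyclic : ¬ (homCplx C I).Acyclic
  homology : ∀ i : ℤ, ∃ b : ℕ, IsoPow ((homCplx C I).homology i) M b

open Classical in
/-- The quasi-projective dimension: `-∞` if `M = 0`, and `+∞` if `M ≠ 0` has no bounded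
quasi-projective resolution. -/
def qpd (M : ModuleCat.{u} R) : EReal :=
  if IsZero M then ⊥ else
    sInf {d : EReal | ∃ P : Cplx R, Bounded P ∧ IsQProjRes M P ∧ d = csup P - hsup P}

open Classical in
/-- The quasi-injective dimension. -/
def qid (M : ModuleCat.{u} R) : EReal :=
  if IsZero M then ⊥ else
    sInf {d : EReal | ∃ I : Cplx R, Bounded I ∧ IsQInjRes M I ∧ d = hinf I - cinf I}

open Classical in
/-- The `C`-quasi-projective dimension. -/
def cqpd (C M : ModuleCat.{u} R) : EReal :=
  if IsZero M then ⊥ else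
    sInf {d : EReal | ∃ P : Cplx R, IsCQProjRes C M P ∧
      d = csup (tensorCplx P C) - hsup (tensorCplx P C)}

open Classical in
/-- The `C`-quasi-injective dimension. -/
def cqid (C M : ModuleCat.{u} R) : EReal :=
  if IsZero M then ⊥ else
    sInf {d : EReal | ∃ I : Cplx R, IsCQInjRes C M I ∧
      d = hinf (homCplx C I) - cinf (homCplx C I)}

end Dimensions

end QuasiDim

end

/-! Foxby equivalence, applied to complexes and to modules at once. For projective `P`, the
isomorphism `R ≅ Hom(C, C)` and the vanishing of `Ext(C, C)` pass to direct sums (as `C` is finitely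
generated over a Noetherian ring) and to summands: `P ≅ Hom(C, P ⊗ C)` and `P ⊗ C` is `Ext(C,
-)`-acyclic. For injective `I`, `C ⊗ Hom(C, I) ≅ I` and `Hom(C, I)` is `Tor(C, -)`-acyclic. So a
bounded complex of either kind gives a pair `Y`, `X` with `X ≅ Y ⊗ C`, `Y ≅ Hom(C, X)` and acyclic
terms (`FoxbyCplx`). A module in the Auslander or Bass class gives a similar pair `A`, `B`
(`FoxbyMod`).

If every `H_i(Y)` is a finite power of `A`, then terms and homology of `Y` are `Tor(C, -)`-acyclic;
induction from the bounded end makes all boundaries and cycles acyclic, so `H_i(Y ⊗ C) ≅ H_i(Y) ⊗ C`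
(`homology_tensorCplx`), the same power of `B`. `Hom(C, -)` gives the converse (`homology_homCplx`).
Hence the two kinds of resolution coincide. Terms and homology vanish in the same degrees on both
sides, so the dimensions agree.

Tor is handled through character modules: `Tor_i(C, N)` vanishes exactly when `Ext^i(C, N⁺)` does,
so Tor arguments become Ext arguments with arrows reversed. -/

namespace QuasiDim

open Abelian

/-! ### Ext-acyclic modules and dimension shifting -/

section Ext

variable {R : Type u} [CommRing R]

/-- `Ext^i_R(C, N) = 0` for all `i > 0`, for unbundled modules. -/
abbrev ExtV (R : Type u) [CommRing R] (C N : Type u) [AddCommGroup C] [Module R C]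
    [AddCommGroup N] [Module R N] : Prop :=
  ExtVanish (ModuleCat.of R C) (ModuleCat.of R N)

variable {C X Y Z : Type u} [AddCommGroup C] [Module R C] [AddCommGroup X] [Module R X]
  [AddCommGroup Y] [Module R Y] [AddCommGroup Z] [Module R Z]

theorem exists_shortExact {f : X →ₗ[R] Y} {g : Y →ₗ[R] Z} (hf : Function.Injective f)
    (hfg : Function.Exact f g) (hg : Function.Surjective g) :
    (ShortComplex.mk (ModuleCat.ofHom f) (ModuleCat.ofHom g)
      (by ext x; exact hfg.apply_apply_eq_zero x)).ShortExact :=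
  ModuleCat.shortComplex_shortExact _ hfg hf hg

theorem ext_middle_of_exact {f : X →ₗ[R] Y} {g : Y →ₗ[R] Z} (hf : Function.Injective f)
    (hfg : Function.Exact f g) (hg : Function.Surjective g) (hX : ExtV R C X) (hZ : ExtV R C Z) :
    ExtV R C Y := fun i hi => by
  refine subsingleton_of_forall_eq 0 fun y => ?_
  obtain ⟨x, rfl⟩ := Ext.covariant_sequence_exact₂ _ (exists_shortExact hf hfg hg) y
    ((hZ i hi).elim _ _)
  rw [(hX i hi).elim x 0, Ext.zero_comp]

theorem ext_right_of_exact {f : X →ₗ[R] Y} {g : Y →ₗ[R] Z} (hf : Function.Injective f)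
    (hfg : Function.Exact f g) (hg : Function.Surjective g) (hX : ExtV R C X) (hY : ExtV R C Y) :
    ExtV R C Z := fun i hi => by
  refine subsingleton_of_forall_eq 0 fun z => ?_
  obtain ⟨y, rfl⟩ := Ext.covariant_sequence_exact₃ _ (exists_shortExact hf hfg hg) z rfl
    ((hX (i + 1) i.succ_pos).elim _ _)
  rw [(hY i hi).elim y 0, Ext.zero_comp]

theorem exists_lift_of_ext {f : X →ₗ[R] Y} {g : Y →ₗ[R] Z} (hf : Function.Injective f)
    (hfg : Function.Exact f g) (hg : Function.Surjective g) (hX : ExtV R C X) (h : C →ₗ[R] Z) :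
    ∃ h' : C →ₗ[R] Y, g ∘ₗ h' = h := by
  obtain ⟨y, hy⟩ := Ext.covariant_sequence_exact₃ _ (exists_shortExact hf hfg hg)
    (Ext.mk₀ (ModuleCat.ofHom h)) rfl ((hX 1 one_pos).elim _ _)
  obtain ⟨y, rfl⟩ := Ext.mk₀_bijective _ _ |>.surjective y
  rw [Ext.mk₀_comp_mk₀] at hy
  have := (Ext.mk₀_bijective _ _).injective hy
  exact ⟨y.hom, congrArg ModuleCat.Hom.hom this⟩

theorem ext_of_injective [Module.Injective R X] : ExtV R C X := fun i hi => by
  obtain ⟨i, rfl⟩ := Nat.exists_eq_succ_of_ne_zero hi.ne'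
  have := Module.injective_object_of_injective_module R X
  exact Ext.subsingleton_of_injective _ _ _

theorem ext_subsingleton_of_retract {n : ℕ} (i : X →ₗ[R] Y) (p : Y →ₗ[R] X)
    (h : p ∘ₗ i = LinearMap.id)
    (hY : Subsingleton (Ext.{u} (ModuleCat.of R C) (ModuleCat.of R Y) n)) :
    Subsingleton (Ext.{u} (ModuleCat.of R C) (ModuleCat.of R X) n) := by
  refine subsingleton_of_forall_eq 0 fun x => ?_
  have : ModuleCat.ofHom i ≫ ModuleCat.ofHom p = 𝟙 (ModuleCat.of R X) := by
    rw [← ModuleCat.ofHom_comp, h]; rfl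
  rw [← Ext.comp_mk₀_id x, ← this, ← Ext.mk₀_comp_mk₀, ← Ext.comp_assoc_of_third_deg_zero,
    hY.elim (x.comp _ _) 0, Ext.zero_comp]

theorem ext_of_retract (i : X →ₗ[R] Y) (p : Y →ₗ[R] X)
    (h : p ∘ₗ i = LinearMap.id) (hY : ExtV R C Y) : ExtV R C X := fun n hn =>
  ext_subsingleton_of_retract i p h (hY n hn)

theorem ext_congr (e : X ≃ₗ[R] Y) (hY : ExtV R C Y) : ExtV R C X :=
  ext_of_retract e.toLinearMap e.symm.toLinearMap (by ext; simp) hY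

theorem ext_of_subsingleton [Subsingleton X] : ExtV R C X := fun n _ => by
  refine subsingleton_of_forall_eq 0 fun x => ?_
  have : 𝟙 (ModuleCat.of R X) = 0 := (ModuleCat.isZero_of_subsingleton _).eq_of_src _ _
  rw [← Ext.comp_mk₀_id x, this, Ext.mk₀_zero, Ext.comp_zero]

/-- Dimension shifting along an injective module. -/
theorem ext_succ_right {f : X →ₗ[R] Y} {g : Y →ₗ[R] Z} (hf : Function.Injective f)
    (hfg : Function.Exact f g) (hg : Function.Surjective g) [Module.Injective R Y] {n : ℕ}
    (hZ : Subsingleton (Ext.{u} (ModuleCat.of R C) (ModuleCat.of R Z) n)) :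
    Subsingleton (Ext.{u} (ModuleCat.of R C) (ModuleCat.of R X) (n + 1)) := by
  refine subsingleton_of_forall_eq 0 fun x => ?_
  have := Module.injective_object_of_injective_module R Y
  obtain ⟨z, rfl⟩ := Ext.covariant_sequence_exact₁ _ (exists_shortExact hf hfg hg) x
    (Ext.eq_zero_of_injective _) rfl
  rw [hZ.elim z 0, Ext.zero_comp]

/-- As `Y` is injective, the connecting map `Hom(C, Z) → Ext^1(C, X)` is onto; it kills every map
that lifts to `Y`. -/
theorem ext_one_right {f : X →ₗ[R] Y} {g : Y →ₗ[R] Z} (hf : Function.Injective f)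
    (hfg : Function.Exact f g) (hg : Function.Surjective g) [Module.Injective R Y]
    (hl : ∀ h : C →ₗ[R] Z, ∃ h' : C →ₗ[R] Y, g ∘ₗ h' = h) :
    Subsingleton (Ext.{u} (ModuleCat.of R C) (ModuleCat.of R X) 1) := by
  refine subsingleton_of_forall_eq 0 fun x => ?_
  have := Module.injective_object_of_injective_module R Y
  have hS := exists_shortExact hf hfg hg
  obtain ⟨z, rfl⟩ := Ext.covariant_sequence_exact₁ _ hS x (Ext.eq_zero_of_injective _) rfl
  obtain ⟨z, rfl⟩ := Ext.mk₀_bijective _ _ |>.surjective z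
  obtain ⟨h', hh'⟩ := hl z.hom
  have : z = ModuleCat.ofHom h' ≫ ModuleCat.ofHom g := ModuleCat.hom_ext hh'.symm
  rw [this, ← Ext.mk₀_comp_mk₀, Ext.comp_assoc_of_second_deg_zero]
  rw [ShortComplex.ShortExact.comp_extClass hS, Ext.comp_zero]

/-- Dimension shifting along a projective module. -/
theorem ext_succ_left {f : X →ₗ[R] Y} {g : Y →ₗ[R] Z} (hf : Function.Injective f)
    (hfg : Function.Exact f g) (hg : Function.Surjective g) [Module.Projective R Y] {n : ℕ}
    (hX : Subsingleton (Ext.{u} (ModuleCat.of R X) (ModuleCat.of R C) n)) :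
    Subsingleton (Ext.{u} (ModuleCat.of R Z) (ModuleCat.of R C) (n + 1)) := by
  refine subsingleton_of_forall_eq 0 fun x => ?_
  have : Projective (ModuleCat.of R Y) := inferInstance
  obtain ⟨z, rfl⟩ := Ext.contravariant_sequence_exact₃ (exists_shortExact hf hfg hg) _ x
    (Ext.eq_zero_of_projective _) (add_comm 1 n)
  rw [hX.elim z 0, Ext.comp_zero]

/-- Passes a vanishing hypothesis to the syzygy `X`. Both degrees are positive because `Ext^{n+1}(Y,
C) = 0` is needed. -/
theorem ext_left_of_succ {f : X →ₗ[R] Y} {g : Y →ₗ[R] Z} (hf : Function.Injective f)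
    (hfg : Function.Exact f g) (hg : Function.Surjective g) [Module.Projective R Y] {n : ℕ}
    (hZ : Subsingleton (Ext.{u} (ModuleCat.of R Z) (ModuleCat.of R C) (n + 2))) :
    Subsingleton (Ext.{u} (ModuleCat.of R X) (ModuleCat.of R C) (n + 1)) := by
  refine subsingleton_of_forall_eq 0 fun x => ?_
  have : Projective (ModuleCat.of R Y) := inferInstance
  obtain ⟨z, rfl⟩ := Ext.contravariant_sequence_exact₁ (exists_shortExact hf hfg hg) _ x
    (by omega : 1 + (n + 1) = n + 2) (hZ.elim _ _)
  rw [Ext.eq_zero_of_projective z, Ext.comp_zero]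

theorem ext_one_left {f : X →ₗ[R] Y} {g : Y →ₗ[R] Z} (hf : Function.Injective f)
    (hfg : Function.Exact f g) (hg : Function.Surjective g) [Module.Projective R Y]
    (hl : ∀ h : X →ₗ[R] C, ∃ h' : Y →ₗ[R] C, h' ∘ₗ f = h) :
    Subsingleton (Ext.{u} (ModuleCat.of R Z) (ModuleCat.of R C) 1) := by
  refine subsingleton_of_forall_eq 0 fun x => ?_
  have : Projective (ModuleCat.of R Y) := inferInstance
  have hS := exists_shortExact hf hfg hg
  obtain ⟨z, rfl⟩ := Ext.contravariant_sequence_exact₃ hS _ x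
    (Ext.eq_zero_of_projective _) (add_comm 1 0)
  obtain ⟨z, rfl⟩ := Ext.mk₀_bijective _ _ |>.surjective z
  obtain ⟨h', hh'⟩ := hl z.hom
  have : z = ModuleCat.ofHom f ≫ ModuleCat.ofHom h' := ModuleCat.hom_ext hh'.symm
  rw [this, ← Ext.mk₀_comp_mk₀, ← Ext.comp_assoc_of_second_deg_zero]
  rw [ShortComplex.ShortExact.extClass_comp hS, Ext.zero_comp]

theorem exists_extend_of_ext_one {f : X →ₗ[R] Y} {g : Y →ₗ[R] Z} (hf : Function.Injective f)
    (hfg : Function.Exact f g) (hg : Function.Surjective g)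
    (hZ : Subsingleton (Ext.{u} (ModuleCat.of R Z) (ModuleCat.of R C) 1)) (h : X →ₗ[R] C) :
    ∃ h' : Y →ₗ[R] C, h' ∘ₗ f = h := by
  obtain ⟨y, hy⟩ := Ext.contravariant_sequence_exact₁ (exists_shortExact hf hfg hg) _
    (Ext.mk₀ (ModuleCat.ofHom h)) (add_zero 1) (hZ.elim _ _)
  obtain ⟨y, rfl⟩ := Ext.mk₀_bijective _ _ |>.surjective y
  rw [Ext.mk₀_comp_mk₀] at hy
  have := (Ext.mk₀_bijective _ _).injective hy
  exact ⟨y.hom, congrArg ModuleCat.Hom.hom this⟩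

theorem ext_pi (hX : ExtV R C X) : ∀ n : ℕ, ExtV R C (Fin n → X)
  | 0 => ext_of_subsingleton
  | n + 1 => by
    have e := (Fin.consLinearEquiv R (fun _ : Fin (n + 1) => X)).symm
    refine ext_congr e ?_
    refine ext_middle_of_exact (f := LinearMap.inl R X (Fin n → X)) (g := LinearMap.snd R _ _)
      LinearMap.inl_injective ?_ LinearMap.snd_surjective hX (ext_pi hX n)
    exact Function.Exact.inl_snd

end Ext

end QuasiDim
namespace QuasiDim

open Abelian

/-! ### Tor-acyclicity through character modules -/

section CharacterModule

variable {R : Type u} [CommRing R]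
variable {C X Y Z : Type u} [AddCommGroup C] [Module R C] [AddCommGroup X] [Module R X]
  [AddCommGroup Y] [Module R Y] [AddCommGroup Z] [Module R Z]

theorem exact_dual {f : X →ₗ[R] Y} {g : Y →ₗ[R] Z} (hfg : Function.Exact f g)
    (hg : Function.Surjective g) :
    Function.Exact (CharacterModule.dual g) (CharacterModule.dual f) := by
  intro c
  constructor
  · intro h
    have hk : ∀ y, g y = 0 → c y = 0 := fun y hy => by
      obtain ⟨x, rfl⟩ := (hfg y).1 hy
      exact DFunLike.congr_fun h x
    refine ⟨(AddMonoidHom.liftOfSurjective g.toAddMonoidHom hg) ⟨c, fun y hy => hk y hy⟩, ?_⟩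
    refine DFunLike.ext _ _ fun y => ?_
    exact AddMonoidHom.liftOfRightInverse_comp_apply g.toAddMonoidHom _
      (Function.rightInverse_surjInv hg) ⟨c, _⟩ y
  · rintro ⟨d, rfl⟩
    refine DFunLike.ext _ _ fun x => ?_
    change d (g (f x)) = 0
    rw [hfg.apply_apply_eq_zero, map_zero]

/-- By adjunction `(C ⊗ X)⁺ ≅ Hom(C, X⁺)`, and a map is injective exactly when its character dual is
surjective. -/
theorem lTensor_injective_iff (f : X →ₗ[R] Y) :
    Function.Injective (f.lTensor C) ↔
      ∀ h : C →ₗ[R] CharacterModule X, ∃ h' : C →ₗ[R] CharacterModule Y,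
        CharacterModule.dual f ∘ₗ h' = h := by
  have key : ∀ h' : C →ₗ[R] CharacterModule Y,
      CharacterModule.homEquiv (CharacterModule.dual f ∘ₗ h') =
        CharacterModule.dual (f.lTensor C) (CharacterModule.homEquiv h') := fun h' => by
    refine CharacterModule.homEquiv.symm.injective ?_
    rw [LinearEquiv.symm_apply_apply]
    rfl
  rw [← CharacterModule.dual_surjective_iff_injective]
  constructor
  · intro hs h
    obtain ⟨k, hk⟩ := hs (CharacterModule.homEquiv h)
    refine ⟨CharacterModule.homEquiv.symm k, CharacterModule.homEquiv.injective ?_⟩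
    rw [key, LinearEquiv.apply_symm_apply, hk]
  · intro hl k
    obtain ⟨h', hh'⟩ := hl (CharacterModule.homEquiv.symm k)
    refine ⟨CharacterModule.homEquiv h', ?_⟩
    rw [← key, hh', LinearEquiv.apply_symm_apply]

/-- The vanishing of `Tor_i(C, N)` for all `i > 0`, expressed through the character module. -/
abbrev TorV (R : Type u) [CommRing R] (C N : Type u) [AddCommGroup C] [Module R C]
    [AddCommGroup N] [Module R N] : Prop :=
  ExtV R C (CharacterModule N)

theorem tor_middle_of_exact {f : X →ₗ[R] Y} {g : Y →ₗ[R] Z} (hf : Function.Injective f)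
    (hfg : Function.Exact f g) (hg : Function.Surjective g) (hX : TorV R C X) (hZ : TorV R C Z) :
    TorV R C Y :=
  ext_middle_of_exact (CharacterModule.dual_injective_of_surjective g hg) (exact_dual hfg hg)
    (CharacterModule.dual_surjective_of_injective f hf) hZ hX

theorem tor_left_of_exact {f : X →ₗ[R] Y} {g : Y →ₗ[R] Z} (hf : Function.Injective f)
    (hfg : Function.Exact f g) (hg : Function.Surjective g) (hY : TorV R C Y) (hZ : TorV R C Z) :
    TorV R C X :=
  ext_right_of_exact (CharacterModule.dual_injective_of_surjective g hg) (exact_dual hfg hg)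
    (CharacterModule.dual_surjective_of_injective f hf) hZ hY

theorem lTensor_injective_of_tor {f : X →ₗ[R] Y} {g : Y →ₗ[R] Z} (hf : Function.Injective f)
    (hfg : Function.Exact f g) (hg : Function.Surjective g) (hZ : TorV R C Z) :
    Function.Injective (f.lTensor C) :=
  (lTensor_injective_iff f).2 <|
    exists_lift_of_ext (CharacterModule.dual_injective_of_surjective g hg) (exact_dual hfg hg)
      (CharacterModule.dual_surjective_of_injective f hf) hZ

theorem tor_of_flat [Module.Flat R X] : TorV R C X := by
  have : Module.Injective R (CharacterModule X) :=
    Module.Flat.iff_characterModule_injective.1 inferInstance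
  exact ext_of_injective

theorem tor_congr (e : X ≃ₗ[R] Y) (hY : TorV R C Y) : TorV R C X :=
  ext_congr (CharacterModule.congr e) hY

theorem tor_of_subsingleton [Subsingleton X] : TorV R C X :=
  have : Subsingleton (CharacterModule X) :=
    ⟨fun a b => DFunLike.ext _ _ fun x => by rw [Subsingleton.elim x 0, map_zero, map_zero]⟩
  ext_of_subsingleton

theorem tor_pi (hX : TorV R C X) : ∀ n : ℕ, TorV R C (Fin n → X)
  | 0 => tor_of_subsingleton
  | n + 1 => by
    refine tor_congr (Fin.consLinearEquiv R (fun _ : Fin (n + 1) => X)).symm ?_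
    exact tor_middle_of_exact (f := LinearMap.inl R X (Fin n → X)) (g := LinearMap.snd R _ _)
      LinearMap.inl_injective Function.Exact.inl_snd LinearMap.snd_surjective hX (tor_pi hX n)

end CharacterModule

/-! ### From the derived functor Tor to character modules -/

section Tor

variable {R : Type u} [CommRing R]

/-- Each `(P n)⁺` is injective, so degree `i + 1` at `Q n` shifts down to degree `i` at `Q (n + 1)`;
in degree one, injectivity of `C ⊗ j` is the lifting property. -/
theorem ext_character_of_syzygies {C : Type u} [AddCommGroup C] [Module R C] {Q P : ℕ → Type u}
    [∀ n, AddCommGroup (Q n)] [∀ n, Module R (Q n)] [∀ n, AddCommGroup (P n)]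
    [∀ n, Module R (P n)] [∀ n, Module.Projective R (P n)]
    (j : ∀ n, Q (n + 1) →ₗ[R] P n) (q : ∀ n, P n →ₗ[R] Q n)
    (hj : ∀ n, Function.Injective (j n)) (hq : ∀ n, Function.Surjective (q n))
    (hjq : ∀ n, Function.Exact (j n) (q n))
    (hC : ∀ n, Function.Injective ((j n).lTensor C)) (i : ℕ) (n : ℕ) :
    Subsingleton (Ext.{u} (ModuleCat.of R C) (ModuleCat.of R (CharacterModule (Q n))) (i + 1)) := by
  have inj : ∀ n, Module.Injective R (CharacterModule (P n)) := fun n =>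
    Module.Flat.iff_characterModule_injective.1 inferInstance
  induction i generalizing n with
  | zero =>
    exact ext_one_right (CharacterModule.dual_injective_of_surjective _ (hq n))
      (exact_dual (hjq n) (hq n)) (CharacterModule.dual_surjective_of_injective _ (hj n))
      ((lTensor_injective_iff (j n)).1 (hC n))
  | succ i ih =>
    exact ext_succ_right (CharacterModule.dual_injective_of_surjective _ (hq n))
      (exact_dual (hjq n) (hq n)) (CharacterModule.dual_surjective_of_injective _ (hj n))
      (ih (n + 1))

/-- Maps `P₂ → P₁ → P₀` that stay exact after tensoring with `C`. -/
theorem lTensor_liftQ_range_injective {C P₀ P₁ P₂ : Type u} [AddCommGroup C] [Module R C]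
    [AddCommGroup P₀] [Module R P₀] [AddCommGroup P₁] [Module R P₁] [AddCommGroup P₂] [Module R P₂]
    (d₂ : P₂ →ₗ[R] P₁) (d₁ : P₁ →ₗ[R] P₀) (h : LinearMap.range d₂ ≤ LinearMap.ker d₁)
    (hC : Function.Exact (d₂.lTensor C) (d₁.lTensor C)) :
    Function.Injective (((LinearMap.range d₂).liftQ d₁ h).lTensor C) := by
  rw [injective_iff_map_eq_zero]
  intro x hx
  obtain ⟨y, rfl⟩ := LinearMap.lTensor_surjective C (LinearMap.range d₂).mkQ_surjective x
  rw [← LinearMap.comp_apply, ← LinearMap.lTensor_comp, Submodule.liftQ_mkQ] at hx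
  obtain ⟨z, rfl⟩ := (hC y).1 hx
  rw [← LinearMap.comp_apply, ← LinearMap.lTensor_comp, LinearMap.range_mkQ_comp]
  simp

theorem TorVanish.tor {C N : ModuleCat.{u} R} (h : TorVanish C N) : TorV R C N := by
  let P := projectiveResolution N
  have hP : ∀ n, Module.Projective R (P.complex.X n) := fun n =>
    (IsProjective.iff_projective (P.complex.X n)).2 (P.projective n)
  have hex : ∀ n, Function.Exact (P.complex.d (n + 2) (n + 1)).hom (P.complex.d (n + 1) n).hom :=
    fun n => (ShortComplex.ShortExact.moduleCat_exact_iff_function_exact _).1 (P.exact_succ n)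
  have h0 : Function.Exact (P.complex.d 1 0).hom (P.π.f 0).hom :=
    (ShortComplex.ShortExact.moduleCat_exact_iff_function_exact _).1 P.exact₀
  have hπ : Function.Surjective (P.π.f 0).hom := (ModuleCat.epi_iff_surjective _).1 inferInstance
  have hC : ∀ n, Function.Exact ((P.complex.d (n + 2) (n + 1)).hom.lTensor C)
      ((P.complex.d (n + 1) n).hom.lTensor C) := fun n => by
    have hz := (h (n + 1) n.succ_pos).of_iso
      (P.isoLeftDerivedObj ((tensoringLeft _).obj C) (n + 1)).symm
    have := (HomologicalComplex.exactAt_iff_isZero_homology _ _).2 hz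
    rw [HomologicalComplex.exactAt_iff' _ (n + 2) (n + 1) n
      (by simp only [ChainComplex.prev]; rfl) (by simp)] at this
    exact (ShortComplex.ShortExact.moduleCat_exact_iff_function_exact _).1 this
  -- Syzygies taken as cokernels: `Q 0 ≅ N`, and `Q (n + 1)` embeds in the `n`-th term by exactness.
  let Q : ℕ → Type u := fun n => P.complex.X n ⧸ LinearMap.range (P.complex.d (n + 1) n).hom
  have hle : ∀ n, LinearMap.range (P.complex.d (n + 2) (n + 1)).hom ≤
      LinearMap.ker (P.complex.d (n + 1) n).hom := fun n => (hex n).linearMap_ker_eq.ge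
  let j : ∀ n, Q (n + 1) →ₗ[R] P.complex.X n := fun n =>
    (LinearMap.range (P.complex.d (n + 2) (n + 1)).hom).liftQ (P.complex.d (n + 1) n).hom (hle n)
  let q : ∀ n, P.complex.X n →ₗ[R] Q n := fun n => Submodule.mkQ _
  have hQ := ext_character_of_syzygies (C := C) j q
    (fun n => LinearMap.ker_eq_bot.1 (Submodule.ker_liftQ_eq_bot _ _ _ (hex n).linearMap_ker_eq.le))
    (fun n => Submodule.mkQ_surjective _)
    (fun n => by
      rw [LinearMap.exact_iff, Submodule.ker_mkQ, Submodule.range_liftQ])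
    (fun n => lTensor_liftQ_range_injective _ _ (hle n) (hC n))
  have e : N ≃ₗ[R] Q 0 := (h0.linearEquivOfSurjective hπ).symm
  refine tor_congr e fun i hi => ?_
  obtain ⟨i, rfl⟩ := Nat.exists_eq_succ_of_ne_zero hi.ne'
  exact hQ i 0

end Tor

end QuasiDim
namespace QuasiDim

open Abelian TensorProduct

/-! ### Tensoring projective modules with `C` -/

section Projective

variable {R : Type u} [CommRing R]

theorem exists_support_bound {C N κ : Type*} [AddCommGroup C] [Module R C] [Module.Finite R C]
    [AddCommGroup N] [Module R N] (h : C →ₗ[R] κ →₀ N) :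
    ∃ S : Finset κ, ∀ k ∉ S, Finsupp.lapply k ∘ₗ h = 0 := by
  classical
  obtain ⟨T, hT⟩ := Module.Finite.fg_top (R := R) (M := C)
  refine ⟨T.biUnion fun c => (h c).support, fun k hk => ?_⟩
  refine LinearMap.ext_on hT fun c hc => ?_
  by_contra hne
  exact hk (Finset.mem_biUnion.2 ⟨c, hc, Finsupp.mem_support_iff.2 hne⟩)

theorem exists_finite_free_cover [IsNoetherianRing R] (A : Type u) [AddCommGroup A] [Module R A]
    [Module.Finite R A] : ∃ (n : ℕ) (K : Type u) (_ : AddCommGroup K) (_ : Module R K)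
      (f : K →ₗ[R] Fin n → R) (g : (Fin n → R) →ₗ[R] A), Module.Finite R K ∧
      Function.Injective f ∧ Function.Exact f g ∧ Function.Surjective g := by
  obtain ⟨n, g, hg⟩ := Module.Finite.exists_fin' R A
  exact ⟨n, LinearMap.ker g, inferInstance, inferInstance, (LinearMap.ker g).subtype, g,
    inferInstance, Subtype.val_injective, LinearMap.exact_subtype_ker_map g, hg⟩

/-- A map from the finitely generated syzygy `K` meets only finitely many summands, so it extends to
the free cover one coordinate at a time. Higher degrees shift to `K`, finitely generated as `R` is
Noetherian. -/
theorem ext_finsupp_subsingleton [IsNoetherianRing R] {N κ : Type u} [AddCommGroup N] [Module R N]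
    (i : ℕ) (A : Type u) [AddCommGroup A] [Module R A] [Module.Finite R A]
    (hA : Subsingleton (Ext.{u} (ModuleCat.of R A) (ModuleCat.of R N) (i + 1))) :
    Subsingleton (Ext.{u} (ModuleCat.of R A) (ModuleCat.of R (κ →₀ N)) (i + 1)) := by
  classical
  induction i generalizing A with
  | zero =>
    obtain ⟨n, K, _, _, f, g, hK, hf, hfg, hg⟩ := exists_finite_free_cover (R := R) A
    refine ext_one_left hf hfg hg fun h => ?_
    obtain ⟨S, hS⟩ := exists_support_bound h
    choose h' hh' using fun k => exists_extend_of_ext_one hf hfg hg hA (Finsupp.lapply k ∘ₗ h)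
    refine ⟨∑ k ∈ S, Finsupp.lsingle k ∘ₗ h' k, ?_⟩
    ext x k
    have hx : ∀ k, h' k (f x) = h x k := fun k => LinearMap.congr_fun (hh' k) x
    simp only [LinearMap.comp_apply, LinearMap.sum_apply, Finsupp.lsingle_apply, hx,
      Finsupp.finsetSum_apply, Finsupp.single_apply, Finset.sum_ite_eq']
    split_ifs with hk
    · rfl
    · exact (LinearMap.congr_fun (hS k hk) x).symm
  | succ i ih =>
    obtain ⟨n, K, _, _, f, g, hK, hf, hfg, hg⟩ := exists_finite_free_cover (R := R) A
    exact ext_succ_left hf hfg hg (ih K (ext_left_of_succ hf hfg hg hA))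

variable {C : Type u} [AddCommGroup C] [Module R C]

theorem ext_tensor_of_projective [IsNoetherianRing R] [Module.Finite R C] (hC : ExtV R C C)
    (P : Type u) [AddCommGroup P] [Module R P] [Module.Projective R P] :
    ExtV R C (P ⊗[R] C) := by
  classical
  obtain ⟨i, hi⟩ := (Module.projective_def' (R := R) (P := P)).1 inferInstance
  have hF : ExtV R C ((P →₀ R) ⊗[R] C) := by
    refine ext_congr (TensorProduct.finsuppScalarLeft R C P) fun n hn => ?_
    obtain ⟨n, rfl⟩ := Nat.exists_eq_succ_of_ne_zero hn.ne'
    exact ext_finsupp_subsingleton n C (hC _ hn)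
  refine ext_of_retract (i.rTensor C) ((Finsupp.linearCombination R id).rTensor C) ?_ hF
  rw [← LinearMap.rTensor_comp, hi, LinearMap.rTensor_id]

/-- Each coordinate of a map `C → C^(κ)` is a unique homothety, and all but finitely many
coordinates vanish. -/
theorem tensor_mk_finsupp_bijective [Module.Finite R C]
    (hC : Function.Bijective (LinearMap.lsmul R C)) (κ : Type u) :
    Function.Bijective (TensorProduct.mk R (κ →₀ R) C) := by
  classical
  have key : ∀ (r : κ →₀ R) (c : C) (k : κ),
      TensorProduct.finsuppScalarLeft R C κ (TensorProduct.mk R (κ →₀ R) C r c) k = r k • c :=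
    fun r c k => by simp
  constructor
  · rw [injective_iff_map_eq_zero]
    intro r hr
    ext k
    refine hC.1 (LinearMap.ext fun c => ?_)
    have := key r c k
    rw [hr] at this
    simpa using this.symm
  · intro h
    obtain ⟨S, hS⟩ := exists_support_bound
      ((TensorProduct.finsuppScalarLeft R C κ).toLinearMap ∘ₗ h)
    choose r hr using fun k => hC.2
      (Finsupp.lapply k ∘ₗ (TensorProduct.finsuppScalarLeft R C κ).toLinearMap ∘ₗ h)
    refine ⟨Finsupp.onFinset S r fun k hk => ?_, ?_⟩
    · by_contra hkS
      exact hk (hC.1 ((hr k).trans ((hS k hkS).trans (map_zero _).symm)))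
    · refine LinearMap.ext fun c => (TensorProduct.finsuppScalarLeft R C κ).injective ?_
      ext k
      rw [key]
      exact LinearMap.congr_fun (hr k) c

theorem tensor_mk_bijective_of_projective [Module.Finite R C]
    (hC : Function.Bijective (LinearMap.lsmul R C)) (P : Type u) [AddCommGroup P] [Module R P]
    [Module.Projective R P] : Function.Bijective (TensorProduct.mk R P C) := by
  obtain ⟨i, hi⟩ := (Module.projective_def' (R := R) (P := P)).1 inferInstance
  set p : (P →₀ R) →ₗ[R] P := Finsupp.linearCombination R id
  have hF := tensor_mk_finsupp_bijective hC P
  have hpi : ∀ x, p (i x) = x := LinearMap.congr_fun hi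
  constructor
  · rw [injective_iff_map_eq_zero]
    intro x hx
    have : i x = 0 := (injective_iff_map_eq_zero _).1 hF.1 _ <| by
      ext c
      have := congrArg (i.rTensor C) (LinearMap.congr_fun hx c)
      simpa using this
    rw [← hpi x, this, map_zero]
  · intro h
    obtain ⟨y, hy⟩ := hF.2 (i.rTensor C ∘ₗ h)
    refine ⟨p y, LinearMap.ext fun c => ?_⟩
    have h1 := congrArg (p.rTensor C) (LinearMap.congr_fun hy c)
    have h2 : p.rTensor C (i.rTensor C (h c)) = h c := by
      rw [← LinearMap.comp_apply, ← LinearMap.rTensor_comp, hi, LinearMap.rTensor_id]; rfl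
    rw [LinearMap.comp_apply, h2] at h1
    rw [← h1]; simp

end Projective

/-! ### Applying `Hom(C, -)` to injective modules -/

section Injective

variable {R : Type u} [CommRing R]

theorem exists_factor_of_injective {X Y I : Type u} [AddCommGroup X] [Module R X]
    [AddCommGroup Y] [Module R Y] [AddCommGroup I] [Module R I] [Module.Injective R I]
    (f : X →ₗ[R] Y) (φ : X →ₗ[R] I) (h : LinearMap.ker f ≤ LinearMap.ker φ) :
    ∃ ψ : Y →ₗ[R] I, ψ ∘ₗ f = φ := by
  obtain ⟨ψ, hψ⟩ := Module.Injective.out ((LinearMap.ker f).liftQ f le_rfl)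
    (LinearMap.ker_eq_bot.1 (Submodule.ker_liftQ_eq_bot _ _ _ le_rfl))
    ((LinearMap.ker f).liftQ φ h)
  exact ⟨ψ, LinearMap.ext fun x => hψ (Submodule.Quotient.mk x)⟩

/-- The map `X ⊗ Hom(C, I) → Hom(Hom(X, C), I)`, `x ⊗ f ↦ (g ↦ f (g x))`. -/
def homEval (R X C I : Type u) [CommRing R] [AddCommGroup X] [Module R X] [AddCommGroup C]
    [Module R C] [AddCommGroup I] [Module R I] :
    X ⊗[R] (C →ₗ[R] I) →ₗ[R] (X →ₗ[R] C) →ₗ[R] I :=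
  TensorProduct.lift ((LinearMap.llcomp R (X →ₗ[R] C) C I).flip ∘ₗ LinearMap.applyₗ)

variable {C I : Type u} [AddCommGroup C] [Module R C] [AddCommGroup I] [Module R I]

@[simp]
theorem homEval_tmul {X : Type u} [AddCommGroup X] [Module R X] (x : X) (f : C →ₗ[R] I)
    (g : X →ₗ[R] C) : homEval R X C I (x ⊗ₜ f) g = f (g x) := rfl

theorem homEval_rTensor {X Y : Type u} [AddCommGroup X] [Module R X] [AddCommGroup Y] [Module R Y]
    (j : X →ₗ[R] Y) (t : X ⊗[R] (C →ₗ[R] I)) (g : Y →ₗ[R] C) :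
    homEval R Y C I (j.rTensor _ t) g = homEval R X C I t (g ∘ₗ j) := by
  induction t with
  | zero => simp
  | tmul x f => rfl
  | add a b ha hb => simp only [map_add, LinearMap.add_apply, ha, hb]

theorem homEval_pi_bijective (n : ℕ) : Function.Bijective (homEval R (Fin n → R) C I) := by
  classical
  -- `ι k` is the `k`-th inclusion `C → C^n ≅ Hom(R^n, C)`; restricting `φ` along each of these
  -- gives the inverse `ψ`.
  let ι : Fin n → C →ₗ[R] (Fin n → R) →ₗ[R] C := fun k => LinearMap.smulRightₗ (LinearMap.proj k)
  let ψ : (((Fin n → R) →ₗ[R] C) →ₗ[R] I) →ₗ[R] (Fin n → R) ⊗[R] (C →ₗ[R] I) :=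
    ∑ k, TensorProduct.mk R _ _ (Pi.single k 1) ∘ₗ (ι k).lcomp R I
  have hψ : ∀ φ, ψ φ = ∑ k, (Pi.single k 1 : Fin n → R) ⊗ₜ[R] (φ ∘ₗ ι k) := fun φ => by
    simp only [ψ, LinearMap.sum_apply]; rfl
  refine Function.bijective_iff_has_inverse.2 ⟨ψ, fun t => ?_, fun φ => ?_⟩
  · induction t with
    | zero => simp
    | tmul x f =>
      have : ∀ k, homEval R (Fin n → R) C I (x ⊗ₜ f) ∘ₗ ι k = x k • f := fun k => by
        ext c
        change f (x k • c) = x k • f c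
        rw [map_smul]
      simp only [hψ, this, TensorProduct.tmul_smul]
      conv_rhs => rw [pi_eq_sum_univ' x, TensorProduct.sum_tmul]
      simp only [TensorProduct.smul_tmul']
    | add a b ha hb => rw [map_add, map_add, ha, hb]
  · refine LinearMap.ext fun g => ?_
    simp only [hψ, map_sum, LinearMap.sum_apply, homEval_tmul, LinearMap.comp_apply]
    rw [← map_sum]
    congr 1
    ext k
    simp [ι, Pi.single_apply]

/-- A cover `R^n → X` embeds `Hom(X, C)` in `Hom(R^n, C)`; injectivity of `I` extends `φ` to the
free case. -/
theorem homEval_surjective [Module.Injective R I] (X : Type u) [AddCommGroup X] [Module R X]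
    [Module.Finite R X] : Function.Surjective (homEval R X C I) := by
  obtain ⟨n, g, hg⟩ := Module.Finite.exists_fin' R X
  intro φ
  obtain ⟨ψ, hψ⟩ := exists_factor_of_injective (g.lcomp R C) φ <| by
    rw [LinearMap.ker_eq_bot.2 (LinearMap.lcomp_injective_of_surjective g hg)]
    exact bot_le
  obtain ⟨t, rfl⟩ := (homEval_pi_bijective n).2 ψ
  refine ⟨g.rTensor _ t, LinearMap.ext fun h => ?_⟩
  rw [homEval_rTensor]
  exact LinearMap.congr_fun hψ h

theorem homEval_bijective [IsNoetherianRing R] [Module.Injective R I] (X : Type u)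
    [AddCommGroup X] [Module R X] [Module.Finite R X] :
    Function.Bijective (homEval R X C I) := by
  refine ⟨?_, homEval_surjective X⟩
  obtain ⟨n, K, _, _, f, g, hK, hf, hfg, hg⟩ := exists_finite_free_cover (R := R) X
  rw [injective_iff_map_eq_zero]
  intro t ht
  obtain ⟨t, rfl⟩ := LinearMap.rTensor_surjective _ hg t
  -- A map `R^n → C` that kills `K` factors through `X`, where `ht` applies. So `homEval t` depends
  -- only on restrictions to `K`, and the resulting `φ` comes from some `s` in `K ⊗ Hom(C, I)`; then
  -- `t` is the image of `s` and dies over `X`.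
  obtain ⟨φ, hφ⟩ := exists_factor_of_injective (f.lcomp R C) (homEval R _ C I t) <| by
    intro h hh
    have hker : LinearMap.ker g ≤ LinearMap.ker h := by
      rw [hfg.linearMap_ker_eq]
      rintro _ ⟨x, rfl⟩
      exact LinearMap.congr_fun hh x
    have : h = ((LinearMap.ker g).liftQ h hker ∘ₗ
        (g.quotKerEquivOfSurjective hg).symm.toLinearMap) ∘ₗ g := by
      ext x
      have : (g.quotKerEquivOfSurjective hg).symm (g (Pi.single x 1)) =
        Submodule.Quotient.mk (Pi.single x 1) := by
        rw [LinearEquiv.symm_apply_eq]; rfl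
      simp [this]
    rw [LinearMap.mem_ker, this, ← homEval_rTensor, ht, LinearMap.zero_apply]
  obtain ⟨s, rfl⟩ := homEval_surjective K φ
  have : t = f.rTensor _ s := (homEval_pi_bijective n).1 <| LinearMap.ext fun h => by
    rw [homEval_rTensor, ← hφ]; rfl
  rw [this, ← LinearMap.comp_apply, ← LinearMap.rTensor_comp,
    LinearMap.ext hfg.apply_apply_eq_zero (f := g ∘ₗ f) (g := 0), LinearMap.rTensor_zero,
    LinearMap.zero_apply]

/-- Take `X = C` in `homEval`: since `Hom(C, C) ≅ R`, its target is `Hom(R, I) ≅ I`, and evaluation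
at the identity of `C` is the evaluation map. -/
theorem eval_bijective_of_injective [IsNoetherianRing R] [Module.Finite R C]
    (hC : Function.Bijective (LinearMap.lsmul R C)) [Module.Injective R I] :
    Function.Bijective
      (TensorProduct.lift (LinearMap.applyₗ : C →ₗ[R] (C →ₗ[R] I) →ₗ[R] I)) := by
  have key : ∀ t, TensorProduct.lift (LinearMap.applyₗ : C →ₗ[R] (C →ₗ[R] I) →ₗ[R] I) t =
      homEval R C C I t LinearMap.id := fun t => by
    induction t with
    | zero => simp
    | tmul x f => rfl
    | add a b ha hb => simp only [map_add, LinearMap.add_apply, ha, hb]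
  constructor
  · rw [injective_iff_map_eq_zero]
    intro t ht
    refine (injective_iff_map_eq_zero _).1 (homEval_bijective C).1 t (LinearMap.ext fun h => ?_)
    obtain ⟨r, rfl⟩ := hC.2 h
    have : LinearMap.lsmul R C r = r • LinearMap.id := rfl
    rw [this, map_smul, ← key, ht, smul_zero, LinearMap.zero_apply]
  · intro y
    let e := LinearEquiv.ofBijective (LinearMap.lsmul R C : R →ₗ[R] C →ₗ[R] C) hC
    obtain ⟨t, ht⟩ := homEval_surjective (I := I) C
      (LinearMap.toSpanSingleton R I y ∘ₗ e.symm.toLinearMap)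
    refine ⟨t, ?_⟩
    have : e.symm LinearMap.id = 1 := by
      rw [LinearEquiv.symm_apply_eq]; ext; simp [e]
    rw [key, ht]
    simp [this]

/-- In essence `Tor_i(A, Hom(C, I)) ≅ Hom(Ext^i(A, C), I)`. In degree one, `homEval` turns
injectivity of `K ⊗ Hom(C, I) → R^n ⊗ Hom(C, I)` into surjectivity of restriction `Hom(R^n, C) →
Hom(K, C)`. -/
theorem ext_hom_character_subsingleton [IsNoetherianRing R] [Module.Injective R I] (i : ℕ)
    (A : Type u) [AddCommGroup A] [Module R A] [Module.Finite R A]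
    (hA : Subsingleton (Ext.{u} (ModuleCat.of R A) (ModuleCat.of R C) (i + 1))) :
    Subsingleton (Ext.{u} (ModuleCat.of R A) (ModuleCat.of R (CharacterModule (C →ₗ[R] I)))
      (i + 1)) := by
  induction i generalizing A with
  | zero =>
    obtain ⟨n, K, _, _, f, g, hK, hf, hfg, hg⟩ := exists_finite_free_cover (R := R) A
    refine ext_one_left hf hfg hg (rTensor_injective_iff_lcomp_surjective.1 ?_)
    rw [injective_iff_map_eq_zero]
    intro t ht
    refine (injective_iff_map_eq_zero _).1 (homEval_bijective K).1 t (LinearMap.ext fun h => ?_)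
    obtain ⟨h, rfl⟩ := exists_extend_of_ext_one hf hfg hg hA h
    rw [← homEval_rTensor, ht, map_zero]; rfl
  | succ i ih =>
    obtain ⟨n, K, _, _, f, g, hK, hf, hfg, hg⟩ := exists_finite_free_cover (R := R) A
    exact ext_succ_left hf hfg hg (ih K (ext_left_of_succ hf hfg hg hA))

theorem tor_hom_of_injective [IsNoetherianRing R] [Module.Finite R C] (hC : ExtV R C C)
    [Module.Injective R I] : TorV R C (C →ₗ[R] I) := fun n hn => by
  obtain ⟨n, rfl⟩ := Nat.exists_eq_succ_of_ne_zero hn.ne'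
  exact ext_hom_character_subsingleton n C (hC _ hn)

end Injective

end QuasiDim
namespace QuasiDim

open Abelian TensorProduct

/-! ### Homology at one spot under `Hom(C, -)` and `- ⊗ C` -/

section ShortComplexHomology

variable {R : Type u} [CommRing R]

theorem homology_linearEquiv (T : ShortComplex (ModuleCat.{u} R)) {K H : Type u} [AddCommGroup K]
    [Module R K] [AddCommGroup H] [Module R H] (f' : T.X₁ →ₗ[R] K) (i : K →ₗ[R] T.X₂)
    (π : K →ₗ[R] H) (hi : Function.Injective i) (hig : Function.Exact i T.g.hom)
    (hf' : i ∘ₗ f' = T.f.hom) (hπ : Function.Surjective π) (hfπ : Function.Exact f' π) :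
    Nonempty (T.homology ≃ₗ[R] H) := by
  let S₁ : ShortComplex (ModuleCat.{u} R) := ShortComplex.mk (ModuleCat.ofHom i) T.g
    (ModuleCat.hom_ext (LinearMap.ext hig.apply_apply_eq_zero))
  let S₂ : ShortComplex (ModuleCat.{u} R) := ShortComplex.mk (ModuleCat.ofHom f')
    (ModuleCat.ofHom π) (ModuleCat.hom_ext (LinearMap.ext hfπ.apply_apply_eq_zero))
  have h₁ : S₁.Exact := ModuleCat.shortComplex_exact S₁ hig
  have h₂ : S₂.Exact := ModuleCat.shortComplex_exact S₂ hfπ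
  have : Mono S₁.f := (ModuleCat.mono_iff_injective _).2 hi
  have : Epi S₂.g := (ModuleCat.epi_iff_surjective _).2 hπ
  have hlift : h₁.fIsKernel.lift (KernelFork.ofι T.f T.zero) = S₂.f := by
    rw [← cancel_mono S₁.f]
    exact (h₁.fIsKernel.fac _ WalkingParallelPair.zero).trans (ModuleCat.hom_ext hf'.symm)
  -- Stated for arbitrary `l` so that the equality with the kernel lift, which is only
  -- propositional, can be substituted.
  have hcok : ∀ (l : T.X₁ ⟶ ModuleCat.of R K) (_ : l = S₂.f) (w : l ≫ S₂.g = 0),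
      Nonempty (IsColimit (CokernelCofork.ofπ S₂.g w)) := by
    rintro _ rfl w
    exact ⟨h₂.gIsCokernel⟩
  let D : T.LeftHomologyData :=
    { K := ModuleCat.of R K
      H := ModuleCat.of R H
      i := S₁.f
      π := S₂.g
      wi := S₁.zero
      hi := h₁.fIsKernel
      wπ := by rw [hlift]; exact S₂.zero
      hπ := (hcok _ hlift _).some }
  exact ⟨D.homologyIso.toLinearEquiv⟩

theorem range_le_ker (S : ShortComplex (ModuleCat.{u} R)) :
    LinearMap.range S.f.hom ≤ LinearMap.ker S.g.hom := by
  rintro _ ⟨x, rfl⟩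
  exact S.moduleCat_zero_apply x

theorem exists_homology_projection (S : ShortComplex (ModuleCat.{u} R)) :
    ∃ π : LinearMap.ker S.g.hom →ₗ[R] S.homology, Function.Surjective π ∧
      Function.Exact (Submodule.inclusion (range_le_ker S)) π := by
  refine ⟨S.moduleCatHomologyIso.symm.toLinearEquiv.toLinearMap ∘ₗ
    (LinearMap.range S.moduleCatToCycles).mkQ, ?_, ?_⟩
  · exact S.moduleCatHomologyIso.symm.toLinearEquiv.surjective.comp (Submodule.mkQ_surjective _)
  · intro z
    refine (LinearEquiv.map_eq_zero_iff S.moduleCatHomologyIso.symm.toLinearEquiv).trans ?_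
    refine (Submodule.Quotient.mk_eq_zero _).trans ?_
    constructor
    · rintro ⟨x, rfl⟩
      exact ⟨⟨S.f.hom x, x, rfl⟩, rfl⟩
    · rintro ⟨⟨_, x, rfl⟩, rfl⟩
      exact ⟨x, rfl⟩

variable {C : ModuleCat.{u} R} (S : ShortComplex (ModuleCat.{u} R))

theorem exact_ker_range {X Y : Type u} [AddCommGroup X] [Module R X] [AddCommGroup Y] [Module R Y]
    (f : X →ₗ[R] Y) : Function.Exact (LinearMap.ker f).subtype f.rangeRestrict := by
  rw [LinearMap.exact_iff, Submodule.range_subtype, LinearMap.ker_rangeRestrict]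

theorem ext_ker_of_range (hB : ExtV R C (LinearMap.range S.f.hom)) (hH : ExtV R C S.homology) :
    ExtV R C (LinearMap.ker S.g.hom) := by
  obtain ⟨π, hπ, hex⟩ := exists_homology_projection S
  exact ext_middle_of_exact (Submodule.inclusion_injective _) hex hπ hB hH

theorem ext_range_of_ker {X Y : Type u} [AddCommGroup X] [Module R X] [AddCommGroup Y] [Module R Y]
    (f : X →ₗ[R] Y) (hK : ExtV R C (LinearMap.ker f)) (hX : ExtV R C X) :
    ExtV R C (LinearMap.range f) :=
  ext_right_of_exact Subtype.val_injective (exact_ker_range f) f.surjective_rangeRestrict hK hX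

theorem tor_ker_of_range {X Y : Type u} [AddCommGroup X] [Module R X] [AddCommGroup Y] [Module R Y]
    (f : X →ₗ[R] Y) (hB : TorV R C (LinearMap.range f)) (hX : TorV R C X) :
    TorV R C (LinearMap.ker f) :=
  tor_left_of_exact Subtype.val_injective (exact_ker_range f) f.surjective_rangeRestrict hX hB

theorem tor_range_of_ker (hK : TorV R C (LinearMap.ker S.g.hom)) (hH : TorV R C S.homology) :
    TorV R C (LinearMap.range S.f.hom) := by
  obtain ⟨π, hπ, hex⟩ := exists_homology_projection S
  exact tor_left_of_exact (Submodule.inclusion_injective _) hex hπ hK hH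

/-- `Hom(C, -)` preserves kernels. Acyclic boundaries make `Hom(C, Z) → Hom(C, H)` onto; acyclic
`ker f` lets maps into the boundaries lift along `f`, so the kernel is the image of `Hom(C, X₁)`. -/
theorem homology_hom (hK : ExtV R C (LinearMap.ker S.f.hom))
    (hB : ExtV R C (LinearMap.range S.f.hom)) :
    Nonempty ((S.map (homFunctor C)).homology ≃ₗ[R] (C →ₗ[R] S.homology)) := by
  obtain ⟨π, hπ, hex⟩ := exists_homology_projection S
  refine homology_linearEquiv (S.map (homFunctor C))
    (K := C →ₗ[R] LinearMap.ker S.g.hom)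
    (LinearMap.compRight R (S.f.hom.codRestrict _ fun x => S.moduleCat_zero_apply x))
    (LinearMap.compRight R (LinearMap.ker S.g.hom).subtype) (LinearMap.compRight R π)
    ?_ ?_ rfl ?_ ?_
  · intro a b hab
    exact LinearMap.ext fun c => Subtype.ext (LinearMap.congr_fun hab c)
  · intro h
    constructor
    · intro hh
      exact ⟨LinearMap.codRestrict _ h fun c => LinearMap.congr_fun hh c, rfl⟩
    · rintro ⟨h, rfl⟩
      exact LinearMap.ext fun c => (h c).2
  · intro h
    exact exists_lift_of_ext (Submodule.inclusion_injective _) hex hπ hB h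
  · intro h
    constructor
    · intro hh
      have hmem : ∀ c, (h c : S.X₂) ∈ LinearMap.range S.f.hom := fun c => by
        obtain ⟨b, hb⟩ := (hex (h c)).1 (LinearMap.congr_fun hh c)
        rw [← hb]
        exact b.2
      obtain ⟨k, hk⟩ := exists_lift_of_ext Subtype.val_injective (exact_ker_range S.f.hom)
        S.f.hom.surjective_rangeRestrict hK
        (LinearMap.codRestrict _ ((LinearMap.ker S.g.hom).subtype ∘ₗ h) hmem)
      have hkc : ∀ c, S.f.hom (k c) = h c := fun c =>
        congrArg Subtype.val (LinearMap.congr_fun hk c)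
      exact ⟨k, LinearMap.ext fun c => Subtype.ext (hkc c)⟩
    · rintro ⟨(k : C →ₗ[R] S.X₁), rfl⟩
      exact LinearMap.ext fun c => (hex _).2 ⟨⟨S.f.hom (k c), k c, rfl⟩, rfl⟩

/-- The inclusion is `B ⊆ Z ⊆ X₂`, with successive quotients the homology and `range g`, both
Tor-acyclic. -/
theorem lTensor_range_subtype_injective (hH : TorV R C S.homology)
    (hB : TorV R C (LinearMap.range S.g.hom)) :
    Function.Injective ((LinearMap.range S.f.hom).subtype.lTensor C) := by
  obtain ⟨π, hπ, hex⟩ := exists_homology_projection S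
  have h₁ := lTensor_injective_of_tor (Submodule.inclusion_injective _) hex hπ hH
  have h₂ := lTensor_injective_of_tor Subtype.val_injective (exact_ker_range S.g.hom)
    S.g.hom.surjective_rangeRestrict hB
  have := h₂.comp h₁
  rwa [← LinearMap.coe_comp, ← LinearMap.lTensor_comp] at this

instance : (S.map (tensorRight C)).HasHomology := CategoryWithHomology.hasHomology _

/-- Right exactness preserves cokernels. The two hypotheses keep `Z ⊗ C` equal to the kernel of `g ⊗
C`: it embeds in `X₂ ⊗ C`, and `range g ⊗ C` embeds in `X₃ ⊗ C`. -/
theorem homology_tensor (hB : TorV R C (LinearMap.range S.g.hom))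
    (hinj : Function.Injective ((LinearMap.range S.g.hom).subtype.lTensor C)) :
    Nonempty ((S.map (tensorRight C)).homology ≃ₗ[R] S.homology ⊗[R] C) := by
  obtain ⟨π, hπ, hex⟩ := exists_homology_projection S
  have hi := lTensor_injective_of_tor Subtype.val_injective (exact_ker_range S.g.hom)
    S.g.hom.surjective_rangeRestrict hB
  rw [LinearMap.lTensor_inj_iff_rTensor_inj] at hi hinj
  have hg : ∀ t : S.X₂ ⊗[R] C, S.g.hom.rTensor C t = 0 ↔
      S.g.hom.rangeRestrict.rTensor C t = 0 := fun t => by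
    rw [← (injective_iff_map_eq_zero' _).1 hinj, ← LinearMap.comp_apply, ← LinearMap.rTensor_comp]
    rfl
  have hf : (LinearMap.ker S.g.hom).subtype.rTensor C ∘ₗ
      (S.f.hom.codRestrict _ fun x => S.moduleCat_zero_apply x).rTensor C =
        S.f.hom.rTensor C := by
    rw [← LinearMap.rTensor_comp]
    rfl
  refine homology_linearEquiv (S.map (tensorRight C))
    (K := LinearMap.ker S.g.hom ⊗[R] C)
    ((S.f.hom.codRestrict _ fun x => S.moduleCat_zero_apply x).rTensor C)
    ((LinearMap.ker S.g.hom).subtype.rTensor C) (π.rTensor C) hi ?_ ?_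
    (LinearMap.rTensor_surjective C hπ) ?_
  · exact fun t => (hg t).trans (rTensor_exact C (exact_ker_range S.g.hom)
      S.g.hom.surjective_rangeRestrict t)
  · exact hf
  · refine rTensor_exact C (fun z => (hex z).trans ?_) hπ
    constructor
    · rintro ⟨⟨_, x, rfl⟩, rfl⟩
      exact ⟨x, rfl⟩
    · rintro ⟨x, rfl⟩
      exact ⟨⟨S.f.hom x, x, rfl⟩, rfl⟩

end ShortComplexHomology

/-! ### Homology of bounded complexes under both functors -/

section ComplexHomology

variable {R : Type u} [CommRing R] {C : ModuleCat.{u} R}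

/-- The short complex `X_{j+2} → X_{j+1} → X_j`. -/
abbrev scAt (X : Cplx R) (j : ℤ) : ShortComplex (ModuleCat.{u} R) := X.sc' (j + 1 + 1) (j + 1) j

/-- The homology of `X` in degree `j + 1`. -/
noncomputable def homologyIsoScAt (X : Cplx R) (j : ℤ) : X.homology (j + 1) ≅ (scAt X j).homology :=
  X.homologyIsoSc' (j + 1 + 1) (j + 1) j (by simp) (by simp)

/-- Descending induction from the degrees where `X` vanishes: acyclicity passes from `B_{j+1}` and
`H_{j+1}` to `Z_{j+1}`, then to its cokernel `B_j` in `X_{j+1}`. -/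
theorem ext_range_d {X : Cplx R} (hX : ∀ i, ExtV R C (X.X i)) (hH : ∀ i, ExtV R C (X.homology i))
    {N : ℤ} (hN : ∀ i, N ≤ i → IsZero (X.X i)) (j : ℤ) :
    ExtV R C (LinearMap.range (X.d (j + 1) j).hom) := by
  have key : ∀ n : ℕ, ∀ j : ℤ, N ≤ j + n → ExtV R C (LinearMap.range (X.d (j + 1) j).hom) := by
    intro n
    induction n with
    | zero =>
      intro j hj
      have : Subsingleton (X.X j) := ModuleCat.subsingleton_of_isZero (hN j (by simpa using hj))
      exact ext_of_subsingleton
    | succ n ih =>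
      intro j hj
      refine ext_range_of_ker _ ?_ (hX _)
      exact ext_ker_of_range (scAt X j) (ih (j + 1) (by push_cast at hj; omega))
        (ext_congr (homologyIsoScAt X j).symm.toLinearEquiv (hH _))
  exact key (N - j).toNat j (by omega)

/-- Ascending induction, since Tor-acyclicity passes to kernels: from `B_j` to `Z_{j+1}` to
`B_{j+1}`. -/
theorem tor_range_d {X : Cplx R} (hX : ∀ i, TorV R C (X.X i)) (hH : ∀ i, TorV R C (X.homology i))
    {N : ℤ} (hN : ∀ i, i ≤ N → IsZero (X.X i)) (j : ℤ) :
    TorV R C (LinearMap.range (X.d (j + 1) j).hom) := by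
  have key : ∀ n : ℕ, ∀ j : ℤ, j ≤ N + n → TorV R C (LinearMap.range (X.d (j + 1) j).hom) := by
    intro n
    induction n with
    | zero =>
      intro j hj
      have : Subsingleton (X.X j) := ModuleCat.subsingleton_of_isZero (hN j (by simpa using hj))
      exact tor_of_subsingleton
    | succ n ih =>
      intro j hj
      obtain ⟨j, rfl⟩ : ∃ k, j = k + 1 := ⟨j - 1, by omega⟩
      exact tor_range_of_ker (scAt X j)
        (tor_ker_of_range _ (ih j (by push_cast at hj; omega)) (hX _))
        (tor_congr (homologyIsoScAt X j).symm.toLinearEquiv (hH _))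
  exact key (j - N).toNat j (by omega)

theorem homology_homCplx {X : Cplx R} (hX : ∀ i, ExtV R C (X.X i))
    (hH : ∀ i, ExtV R C (X.homology i)) {N : ℤ} (hN : ∀ i, N ≤ i → IsZero (X.X i)) (i : ℤ) :
    Nonempty ((homCplx C X).homology i ≃ₗ[R] (C →ₗ[R] X.homology i)) := by
  obtain ⟨j, rfl⟩ : ∃ k, i = k + 1 := ⟨i - 1, by omega⟩
  have hB := ext_range_d hX hH hN
  have hK : ExtV R C (LinearMap.ker (X.d (j + 1 + 1) (j + 1)).hom) :=
    ext_ker_of_range (scAt X (j + 1)) (hB _)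
      (ext_congr (homologyIsoScAt X (j + 1)).symm.toLinearEquiv (hH _))
  obtain ⟨e⟩ := homology_hom (scAt X j) hK (hB (j + 1))
  exact ⟨(homologyIsoScAt (homCplx C X) j).toLinearEquiv ≪≫ₗ e ≪≫ₗ
    (homologyIsoScAt X j).symm.toLinearEquiv.congrRight⟩

theorem homology_tensorCplx {X : Cplx R} (hX : ∀ i, TorV R C (X.X i))
    (hH : ∀ i, TorV R C (X.homology i)) {N : ℤ} (hN : ∀ i, i ≤ N → IsZero (X.X i)) (i : ℤ) :
    Nonempty ((tensorCplx X C).homology i ≃ₗ[R] X.homology i ⊗[R] C) := by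
  -- Two shifts: `B_{j+1} ⊗ C → X_{j+1} ⊗ C` is injective by the short complex one degree below the
  -- one being computed.
  obtain ⟨j, rfl⟩ : ∃ k, i = k + 1 + 1 := ⟨i - 2, by omega⟩
  have hB := tor_range_d hX hH hN
  have hH' : TorV R C (scAt X j).homology :=
    tor_congr (homologyIsoScAt X j).symm.toLinearEquiv (hH _)
  obtain ⟨e⟩ := homology_tensor (scAt X (j + 1)) (hB (j + 1))
    (lTensor_range_subtype_injective (scAt X j) hH' (hB j))
  exact ⟨(homologyIsoScAt (tensorCplx X C) (j + 1)).toLinearEquiv ≪≫ₗ e ≪≫ₗ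
    (homologyIsoScAt X (j + 1)).symm.toLinearEquiv.rTensor C⟩

end ComplexHomology

end QuasiDim
namespace QuasiDim

open Abelian TensorProduct

/-! ### Bounds and a uniform description of resolutions -/

section Sup

variable {R : Type u} [CommRing R]

theorem isZero_of_csup_lt {X : Cplx R} {i : ℤ} (h : csup X < ((i : ℝ) : EReal)) :
    IsZero (X.X i) := by
  by_contra hi
  have : ((i : ℝ) : EReal) ≤ csup X := le_sSup ⟨i, hi, rfl⟩
  exact absurd this (not_le.2 h)

theorem isZero_of_lt_cinf {X : Cplx R} {i : ℤ} (h : ((i : ℝ) : EReal) < cinf X) :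
    IsZero (X.X i) := by
  by_contra hi
  have : cinf X ≤ ((i : ℝ) : EReal) := sInf_le ⟨i, hi, rfl⟩
  exact absurd this (not_le.2 h)

theorem BoundedAbove.exists_isZero {X : Cplx R} (h : BoundedAbove X) :
    ∃ N : ℤ, ∀ i, N ≤ i → IsZero (X.X i) := by
  obtain ⟨r, hr, -⟩ := EReal.lt_iff_exists_real_btwn.1 h
  refine ⟨⌈r⌉, fun i hi => isZero_of_csup_lt (hr.trans_le ?_)⟩
  exact_mod_cast Int.ceil_le.1 hi

theorem BoundedBelow.exists_isZero {X : Cplx R} (h : BoundedBelow X) :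
    ∃ N : ℤ, ∀ i, i ≤ N → IsZero (X.X i) := by
  obtain ⟨r, -, hr⟩ := EReal.lt_iff_exists_real_btwn.1 h
  refine ⟨⌊r⌋, fun i hi => isZero_of_lt_cinf (lt_of_le_of_lt ?_ hr)⟩
  exact_mod_cast Int.le_floor.1 hi

theorem isZero_homology_of_isZero {X : Cplx R} {i : ℤ} (h : IsZero (X.X i)) :
    IsZero (X.homology i) :=
  (X.exactAt_iff_isZero_homology i).1 (ShortComplex.exact_of_isZero_X₂ _ h)

theorem csup_congr {X Y : Cplx R} (h : ∀ i, IsZero (X.X i) ↔ IsZero (Y.X i)) :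
    csup X = csup Y := by
  simp only [csup, h]

theorem cinf_congr {X Y : Cplx R} (h : ∀ i, IsZero (X.X i) ↔ IsZero (Y.X i)) :
    cinf X = cinf Y := by
  simp only [cinf, h]

theorem hsup_congr {X Y : Cplx R} (h : ∀ i, IsZero (X.homology i) ↔ IsZero (Y.homology i)) :
    hsup X = hsup Y := by
  simp only [hsup, h]

theorem hinf_congr {X Y : Cplx R} (h : ∀ i, IsZero (X.homology i) ↔ IsZero (Y.homology i)) :
    hinf X = hinf Y := by
  simp only [hinf, h]

theorem isZero_iff_subsingleton (M : ModuleCat.{u} R) : IsZero M ↔ Subsingleton M :=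
  ⟨fun h => ModuleCat.subsingleton_of_isZero h, fun _ => ModuleCat.isZero_of_subsingleton M⟩

theorem isoPow_zero_of_isZero {N : ModuleCat.{u} R} (M : ModuleCat.{u} R) (h : IsZero N) :
    IsoPow N M 0 :=
  have := (isZero_iff_subsingleton N).1 h
  ⟨⟨0, 0, fun _ => Subsingleton.elim _ _, fun _ => Subsingleton.elim _ _⟩⟩

theorem IsoPow.isZero_iff {N M : ModuleCat.{u} R} [Nontrivial M] {a : ℕ} (h : IsoPow N M a) :
    IsZero N ↔ a = 0 := by
  obtain ⟨e⟩ := h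
  rw [isZero_iff_subsingleton, e.toEquiv.subsingleton_congr]
  constructor
  · intro h
    by_contra ha
    have : Nonempty (Fin a) := ⟨⟨0, Nat.pos_of_ne_zero ha⟩⟩
    exact not_nontrivial (Fin a → M) inferInstance
  · rintro rfl
    infer_instance

/-- The homology modules of `X` are finite direct sums of copies of `M`, not all zero. -/
def IsResOf (M : ModuleCat.{u} R) (X : Cplx R) : Prop :=
  ¬ X.Acyclic ∧ ∀ i, ∃ a : ℕ, IsoPow (X.homology i) M a

theorem not_acyclic_iff (X : Cplx R) : ¬ X.Acyclic ↔ ∃ i, ¬ IsZero (X.homology i) := by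
  simp only [HomologicalComplex.acyclic_iff, HomologicalComplex.exactAt_iff_isZero_homology,
    not_forall]

/-- Outside `p` the terms vanish, so the exponents there may be taken zero. `M ≠ 0` makes a nonzero
exponent equivalent to nonzero homology. -/
theorem isResOf_iff (M : ModuleCat.{u} R) [Nontrivial M] (X : Cplx R) (p : ℤ → Prop)
    (hp : ∀ i, ¬ p i → IsZero (X.X i)) :
    (∃ a : ℤ → ℕ, (∃ i, p i ∧ a i ≠ 0) ∧ ∀ i, p i → IsoPow (X.homology i) M (a i)) ↔
      IsResOf M X := by
  classical
  rw [IsResOf, not_acyclic_iff]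
  constructor
  · rintro ⟨a, ⟨i, hi, hai⟩, ha⟩
    refine ⟨⟨i, fun h => hai ((ha i hi).isZero_iff.1 h)⟩, fun j => ?_⟩
    by_cases hj : p j
    · exact ⟨a j, ha j hj⟩
    · exact ⟨0, isoPow_zero_of_isZero M (isZero_homology_of_isZero (hp j hj))⟩
  · rintro ⟨⟨i, hi⟩, h⟩
    choose a ha using h
    refine ⟨a, ⟨i, ?_, fun h => hi ((ha i).isZero_iff.2 h)⟩, fun j _ => ha j⟩
    by_contra hpi
    exact hi (isZero_homology_of_isZero (hp i hpi))

theorem isQProjRes_iff (M : ModuleCat.{u} R) [Nontrivial M] (P : Cplx R) :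
    Bounded P ∧ IsQProjRes M P ↔
      Bounded P ∧ (∀ i, Module.Projective R (P.X i)) ∧ IsResOf M P := by
  have h := isResOf_iff M P (fun i => cinf P ≤ ((i : ℝ) : EReal))
    fun i hi => isZero_of_lt_cinf (not_le.1 hi)
  exact ⟨fun ⟨hb, hP⟩ => ⟨hb, hP.projective, h.1 hP.homology⟩,
    fun ⟨hb, hP, hr⟩ => ⟨hb, hb.1, hP, h.2 hr⟩⟩

theorem isQInjRes_iff (M : ModuleCat.{u} R) [Nontrivial M] (I : Cplx R) :
    Bounded I ∧ IsQInjRes M I ↔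
      Bounded I ∧ (∀ i, Module.Injective R (I.X i)) ∧ IsResOf M I := by
  have h := isResOf_iff M I (fun i => ((i : ℝ) : EReal) ≤ csup I)
    fun i hi => isZero_of_csup_lt (not_le.1 hi)
  exact ⟨fun ⟨hb, hI⟩ => ⟨hb, hI.injective, h.1 hI.homology⟩,
    fun ⟨hb, hI, hr⟩ => ⟨hb, hb.2, hI, h.2 hr⟩⟩

theorem isCQProjRes_iff (C M : ModuleCat.{u} R) (P : Cplx R) :
    IsCQProjRes C M P ↔
      Bounded P ∧ (∀ i, Module.Projective R (P.X i)) ∧ IsResOf M (tensorCplx P C) :=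
  ⟨fun h => ⟨h.bounded, h.projective, h.not_acyclic, h.homology⟩,
    fun ⟨hb, hP, hr⟩ => ⟨hb, hP, hr.1, hr.2⟩⟩

theorem isCQInjRes_iff (C M : ModuleCat.{u} R) (I : Cplx R) :
    IsCQInjRes C M I ↔
      Bounded I ∧ (∀ i, Module.Injective R (I.X i)) ∧ IsResOf M (homCplx C I) :=
  ⟨fun h => ⟨h.bounded, h.injective, h.not_acyclic, h.homology⟩,
    fun ⟨hb, hI, hr⟩ => ⟨hb, hI, hr.1, hr.2⟩⟩

end Sup

/-! ### Foxby pairs and the transfer of resolutions -/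

section Foxby

variable {R : Type u} [CommRing R]

/-- Bounded complexes `Y` and `X` that correspond to each other under `- ⊗ C` and `Hom(C, -)`,
with terms acyclic for these functors. -/
structure FoxbyCplx (C : ModuleCat.{u} R) (Y X : Cplx R) : Prop where
  tensor : Nonempty (tensorCplx Y C ≅ X)
  hom : Nonempty (homCplx C X ≅ Y)
  tor : ∀ i, TorV R C (Y.X i)
  ext : ∀ i, ExtV R C (X.X i)
  below : ∃ N : ℤ, ∀ i, i ≤ N → IsZero (Y.X i)
  above : ∃ N : ℤ, ∀ i, N ≤ i → IsZero (X.X i)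

/-- Modules `A` and `B` that correspond to each other under `- ⊗ C` and `Hom(C, -)` and are
acyclic for these functors. -/
structure FoxbyMod (C A B : ModuleCat.{u} R) : Prop where
  tensor : Nonempty (A ⊗[R] C ≃ₗ[R] B)
  hom : Nonempty ((C →ₗ[R] B) ≃ₗ[R] A)
  tor : TorV R C A
  ext : ExtV R C B

variable {C A B : ModuleCat.{u} R} {X Y : Cplx R}

theorem FoxbyMod.nontrivial_iff (h : FoxbyMod C A B) : Nontrivial A ↔ Nontrivial B := by
  obtain ⟨e⟩ := h.tensor
  obtain ⟨e'⟩ := h.hom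
  rw [← not_iff_not, not_nontrivial_iff_subsingleton, not_nontrivial_iff_subsingleton]
  constructor
  · intro _
    exact e.symm.toEquiv.subsingleton
  · intro _
    exact e'.symm.toEquiv.subsingleton

theorem FoxbyMod.isZero_iff (h : FoxbyMod C A B) : IsZero A ↔ IsZero B := by
  rw [isZero_iff_subsingleton, isZero_iff_subsingleton, ← not_nontrivial_iff_subsingleton,
    ← not_nontrivial_iff_subsingleton, h.nontrivial_iff]

theorem isZero_tensorMod {N : ModuleCat.{u} R} (h : IsZero N) :
    IsZero (ModuleCat.of R (N ⊗[R] C)) := by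
  have := ModuleCat.subsingleton_of_isZero h
  exact ModuleCat.isZero_of_subsingleton _

theorem isZero_homMod {N : ModuleCat.{u} R} (h : IsZero N) : IsZero (homMod C N) := by
  have := ModuleCat.subsingleton_of_isZero h
  exact ModuleCat.isZero_of_subsingleton _

theorem FoxbyCplx.isZero_iff (h : FoxbyCplx C Y X) (i : ℤ) : IsZero (Y.X i) ↔ IsZero (X.X i) := by
  obtain ⟨e⟩ := h.tensor
  obtain ⟨e'⟩ := h.hom
  constructor
  · intro hY
    exact (isZero_tensorMod (C := C) hY).of_iso ((HomologicalComplex.eval _ _ i).mapIso e.symm)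
  · intro hX
    exact (isZero_homMod (C := C) hX).of_iso ((HomologicalComplex.eval _ _ i).mapIso e'.symm)

theorem FoxbyCplx.isoPow_tensor (h : FoxbyCplx C Y X) (hAB : FoxbyMod C A B) {a : ℤ → ℕ}
    (ha : ∀ i, IsoPow (Y.homology i) A (a i)) (i : ℤ) : IsoPow (X.homology i) B (a i) := by
  obtain ⟨N, hN⟩ := h.below
  obtain ⟨e⟩ := h.tensor
  obtain ⟨eB⟩ := hAB.tensor
  obtain ⟨e₁⟩ := homology_tensorCplx h.tor
    (fun i => tor_congr (ha i).some (tor_pi hAB.tor _)) hN i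
  obtain ⟨eA⟩ := ha i
  have e₂ := ((HomologicalComplex.homologyFunctor _ _ i).mapIso e.symm).toLinearEquiv
  exact ⟨e₂ ≪≫ₗ e₁ ≪≫ₗ eA.rTensor C ≪≫ₗ TensorProduct.comm R _ _ ≪≫ₗ
    TensorProduct.piRight R R C (fun _ : Fin (a i) => A) ≪≫ₗ
    LinearEquiv.piCongrRight fun _ => TensorProduct.comm R _ _ ≪≫ₗ eB⟩

/-- `Hom(C, B^n) ≃ Hom(C, B)^n`. -/
def homPiEquiv (C B : ModuleCat.{u} R) (n : ℕ) : (C →ₗ[R] Fin n → B) ≃ₗ[R] Fin n → C →ₗ[R] B where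
  toFun h k := LinearMap.proj k ∘ₗ h
  map_add' _ _ := rfl
  map_smul' _ _ := rfl
  invFun := LinearMap.pi
  left_inv _ := rfl
  right_inv _ := rfl

theorem FoxbyCplx.isoPow_hom (h : FoxbyCplx C Y X) (hAB : FoxbyMod C A B) {a : ℤ → ℕ}
    (ha : ∀ i, IsoPow (X.homology i) B (a i)) (i : ℤ) : IsoPow (Y.homology i) A (a i) := by
  obtain ⟨N, hN⟩ := h.above
  obtain ⟨e⟩ := h.hom
  obtain ⟨eA⟩ := hAB.hom
  obtain ⟨e₁⟩ := homology_homCplx h.ext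
    (fun i => ext_congr (ha i).some (ext_pi hAB.ext _)) hN i
  obtain ⟨eB⟩ := ha i
  have e₂ := ((HomologicalComplex.homologyFunctor _ _ i).mapIso e.symm).toLinearEquiv
  exact ⟨e₂ ≪≫ₗ e₁ ≪≫ₗ eB.congrRight ≪≫ₗ
    homPiEquiv C B (a i) ≪≫ₗ
    LinearEquiv.piCongrRight fun _ => eA⟩

/-- Both functors carry the exponents over unchanged, and for nonzero `A`, `B` the exponent detects
vanishing. -/
theorem FoxbyCplx.isResOf (h : FoxbyCplx C Y X) (hAB : FoxbyMod C A B) [Nontrivial A] :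
    (IsResOf A Y ↔ IsResOf B X) ∧
      (IsResOf A Y → ∀ i, IsZero (Y.homology i) ↔ IsZero (X.homology i)) := by
  have : Nontrivial B := hAB.nontrivial_iff.1 inferInstance
  have key : ∀ a : ℤ → ℕ, (∀ i, IsoPow (Y.homology i) A (a i)) →
      (∀ i, IsoPow (X.homology i) B (a i)) →
      ∀ i, IsZero (Y.homology i) ↔ IsZero (X.homology i) := fun a h₁ h₂ i => by
    rw [(h₁ i).isZero_iff, (h₂ i).isZero_iff]
  refine ⟨⟨fun hr => ?_, fun hr => ?_⟩, fun hr => ?_⟩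
  · choose a ha using hr.2
    have ha' := h.isoPow_tensor hAB ha
    refine ⟨?_, fun i => ⟨a i, ha' i⟩⟩
    have := hr.1
    rw [not_acyclic_iff] at this ⊢
    simpa only [key a ha ha'] using this
  · choose a ha using hr.2
    have ha' := h.isoPow_hom hAB ha
    refine ⟨?_, fun i => ⟨a i, ha' i⟩⟩
    have := hr.1
    rw [not_acyclic_iff] at this ⊢
    simpa only [key a ha' ha] using this
  · choose a ha using hr.2
    exact key a ha (h.isoPow_tensor hAB ha)

theorem foxbyCplx_of_projective [IsNoetherianRing R] (hC : IsSemidualizing C) {P : Cplx R}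
    (hb : Bounded P) (hP : ∀ i, Module.Projective R (P.X i)) : FoxbyCplx C P (tensorCplx P C) := by
  have := hC.finite
  refine ⟨⟨Iso.refl _⟩, ⟨(HomologicalComplex.Hom.isoOfComponents (fun i => LinearEquiv.toModuleIso
    (LinearEquiv.ofBijective (TensorProduct.mk R (P.X i) C)
      (tensor_mk_bijective_of_projective hC.homothety _))) fun i j _ => rfl).symm⟩,
    fun i => tor_of_flat, fun i => ext_tensor_of_projective hC.ext _, hb.1.exists_isZero, ?_⟩
  obtain ⟨N, hN⟩ := hb.2.exists_isZero
  exact ⟨N, fun i hi => isZero_tensorMod (hN i hi)⟩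

theorem eval_flip_bijective {M : Type u} [AddCommGroup M] [Module R M]
    (h : Function.Bijective (TensorProduct.lift
      (LinearMap.applyₗ : C →ₗ[R] (C →ₗ[R] M) →ₗ[R] M))) :
    Function.Bijective
      (TensorProduct.lift (LinearMap.id : (C →ₗ[R] M) →ₗ[R] C →ₗ[R] M)) := by
  have : TensorProduct.lift (LinearMap.id : (C →ₗ[R] M) →ₗ[R] C →ₗ[R] M) =
      TensorProduct.lift LinearMap.applyₗ ∘ₗ (TensorProduct.comm R (C →ₗ[R] M) C).toLinearMap :=
    TensorProduct.ext' fun f c => rfl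
  rw [this, LinearMap.coe_comp]
  exact h.comp (TensorProduct.comm R _ _).bijective

theorem foxbyCplx_of_injective [IsNoetherianRing R] (hC : IsSemidualizing C) {I : Cplx R}
    (hb : Bounded I) (hI : ∀ i, Module.Injective R (I.X i)) : FoxbyCplx C (homCplx C I) I := by
  have := hC.finite
  refine ⟨⟨HomologicalComplex.Hom.isoOfComponents (fun i => LinearEquiv.toModuleIso
    (LinearEquiv.ofBijective (TensorProduct.lift (LinearMap.id (M := C →ₗ[R] I.X i)))
      (eval_flip_bijective (eval_bijective_of_injective hC.homothety)))) fun i j _ => ?_⟩,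
    ⟨Iso.refl _⟩, fun i => tor_hom_of_injective hC.ext, fun i => ext_of_injective,
    ?_, hb.2.exists_isZero⟩
  · refine ModuleCat.hom_ext (TensorProduct.ext' fun f c => rfl)
  · obtain ⟨N, hN⟩ := hb.1.exists_isZero
    exact ⟨N, fun i hi => isZero_homMod (hN i hi)⟩

theorem InAuslander.foxbyMod {M : ModuleCat.{u} R} (h : InAuslander C M) :
    FoxbyMod C M (tensorMod C M) :=
  ⟨⟨TensorProduct.comm R _ _⟩, ⟨(LinearEquiv.ofBijective _ h.unit).symm⟩, h.tor.tor, h.ext⟩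

theorem InBass.foxbyMod {M : ModuleCat.{u} R} (h : InBass C M) :
    FoxbyMod C (homMod C M) M :=
  ⟨⟨LinearEquiv.ofBijective _ (eval_flip_bijective h.eval)⟩, ⟨LinearEquiv.refl R _⟩, h.tor.tor,
    h.ext⟩

theorem isCQProjRes_iff_isQProjRes [IsNoetherianRing R] (hC : IsSemidualizing C)
    (hAB : FoxbyMod C A B) [Nontrivial A] (P : Cplx R) :
    IsCQProjRes C B P ↔ Bounded P ∧ IsQProjRes A P := by
  rw [isCQProjRes_iff, isQProjRes_iff]
  refine and_congr_right fun hb => and_congr_right fun hP => ?_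
  exact ((foxbyCplx_of_projective hC hb hP).isResOf hAB).1.symm

theorem isCQInjRes_iff_isQInjRes [IsNoetherianRing R] (hC : IsSemidualizing C)
    (hAB : FoxbyMod C A B) [Nontrivial A] (I : Cplx R) :
    IsCQInjRes C A I ↔ Bounded I ∧ IsQInjRes B I := by
  have : Nontrivial B := hAB.nontrivial_iff.1 inferInstance
  rw [isCQInjRes_iff, isQInjRes_iff]
  refine and_congr_right fun hb => and_congr_right fun hI => ?_
  exact ((foxbyCplx_of_injective hC hb hI).isResOf hAB).1

/-- For `A ≠ 0` both infima run over the same complexes `P`, and `P` and `P ⊗ C` have nonzero terms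
and homology in the same degrees. -/
theorem cqpd_eq_qpd [IsNoetherianRing R] (hC : IsSemidualizing C)
    (hAB : FoxbyMod C A B) : cqpd C B = qpd A := by
  by_cases hA : IsZero A
  · rw [cqpd, qpd, if_pos hA, if_pos (hAB.isZero_iff.1 hA)]
  have : Nontrivial A := by
    rwa [isZero_iff_subsingleton, not_subsingleton_iff_nontrivial] at hA
  rw [cqpd, qpd, if_neg hA, if_neg (mt hAB.isZero_iff.2 hA)]
  congr 1
  ext d
  refine exists_congr fun P => ?_
  rw [isCQProjRes_iff_isQProjRes hC hAB, and_assoc]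
  refine and_congr_right fun hb => and_congr_right fun hP => ?_
  have hF := foxbyCplx_of_projective hC hb hP.projective
  rw [csup_congr hF.isZero_iff,
    hsup_congr ((hF.isResOf hAB).2 ((isQProjRes_iff A P).1 ⟨hb, hP⟩).2.2)]

theorem cqid_eq_qid [IsNoetherianRing R] (hC : IsSemidualizing C)
    (hAB : FoxbyMod C A B) : cqid C A = qid B := by
  by_cases hA : IsZero A
  · rw [cqid, qid, if_pos hA, if_pos (hAB.isZero_iff.1 hA)]
  have : Nontrivial A := by
    rwa [isZero_iff_subsingleton, not_subsingleton_iff_nontrivial] at hA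
  rw [cqid, qid, if_neg hA, if_neg (mt hAB.isZero_iff.2 hA)]
  congr 1
  ext d
  refine exists_congr fun I => ?_
  refine Iff.trans (and_congr_right fun hI => ?_)
    ((and_congr_left' (isCQInjRes_iff_isQInjRes hC hAB I)).trans and_assoc)
  have hF := foxbyCplx_of_injective hC hI.bounded hI.injective
  rw [cinf_congr hF.isZero_iff,
    hinf_congr ((hF.isResOf hAB).2 ((isCQInjRes_iff C A I).1 hI).2.2)]

end Foxby

end QuasiDim

/-- The Foxby pair is `(M, C ⊗ M)` in the Auslander case and `(Hom(C, M), M)` in the Bass case. -/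
theorem mainTheorem5 {R : Type u} [CommRing R] [IsNoetherianRing R]
    (C : ModuleCat.{u} R) (hC : QuasiDim.IsSemidualizing C) :
    (∀ M : ModuleCat.{u} R, QuasiDim.InBass C M →
      (QuasiDim.cqpd C M < ⊤ ↔ QuasiDim.qpd (QuasiDim.homMod C M) < ⊤) ∧
      QuasiDim.cqpd C M = QuasiDim.qpd (QuasiDim.homMod C M) ∧
      (Nontrivial M → ∀ P : QuasiDim.Cplx R, QuasiDim.IsCQProjRes C M P ↔
        QuasiDim.Bounded P ∧ QuasiDim.IsQProjRes (QuasiDim.homMod C M) P)) ∧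
    (∀ M : ModuleCat.{u} R, QuasiDim.InAuslander C M →
      (QuasiDim.qpd M < ⊤ ↔ QuasiDim.cqpd C (QuasiDim.tensorMod C M) < ⊤) ∧
      QuasiDim.qpd M = QuasiDim.cqpd C (QuasiDim.tensorMod C M) ∧
      (Nontrivial M → ∀ P : QuasiDim.Cplx R,
        QuasiDim.Bounded P ∧ QuasiDim.IsQProjRes M P ↔
        QuasiDim.IsCQProjRes C (QuasiDim.tensorMod C M) P)) ∧
    (∀ M : ModuleCat.{u} R, QuasiDim.InAuslander C M →
      (QuasiDim.cqid C M < ⊤ ↔ QuasiDim.qid (QuasiDim.tensorMod C M) < ⊤) ∧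
      QuasiDim.cqid C M = QuasiDim.qid (QuasiDim.tensorMod C M) ∧
      (Nontrivial M → ∀ I : QuasiDim.Cplx R, QuasiDim.IsCQInjRes C M I ↔
        QuasiDim.Bounded I ∧ QuasiDim.IsQInjRes (QuasiDim.tensorMod C M) I)) ∧
    (∀ M : ModuleCat.{u} R, QuasiDim.InBass C M →
      (QuasiDim.cqid C (QuasiDim.homMod C M) < ⊤ ↔ QuasiDim.qid M < ⊤) ∧
      QuasiDim.cqid C (QuasiDim.homMod C M) = QuasiDim.qid M ∧
      (Nontrivial M → ∀ I : QuasiDim.Cplx R,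
        QuasiDim.Bounded I ∧ QuasiDim.IsQInjRes M I ↔
        QuasiDim.IsCQInjRes C (QuasiDim.homMod C M) I)) := by
  refine ⟨fun M hM => ?_, fun M hM => ?_, fun M hM => ?_, fun M hM => ?_⟩
  · have h := QuasiDim.cqpd_eq_qpd hC hM.foxbyMod
    refine ⟨by rw [h], h, fun _ P => ?_⟩
    have : Nontrivial (QuasiDim.homMod C M) := hM.foxbyMod.nontrivial_iff.2 inferInstance
    exact QuasiDim.isCQProjRes_iff_isQProjRes hC hM.foxbyMod P
  · have h := QuasiDim.cqpd_eq_qpd hC hM.foxbyMod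
    exact ⟨by rw [h], h.symm, fun _ P =>
      (QuasiDim.isCQProjRes_iff_isQProjRes hC hM.foxbyMod P).symm⟩
  · have h := QuasiDim.cqid_eq_qid hC hM.foxbyMod
    exact ⟨by rw [h], h, fun _ I => QuasiDim.isCQInjRes_iff_isQInjRes hC hM.foxbyMod I⟩
  · have h := QuasiDim.cqid_eq_qid hC hM.foxbyMod
    refine ⟨by rw [h], h, fun _ I => ?_⟩
    have : Nontrivial (QuasiDim.homMod C M) := hM.foxbyMod.nontrivial_iff.2 inferInstance
    exact (QuasiDim.isCQInjRes_iff_isQInjRes hC hM.foxbyMod I).symm
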